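/- Throughout, $n\ge 1$, functions are real- or complex-valued on $\mathbb R^n$, $|x|$ is the Euclidean norm, $B_k=\{x\in\mathbb R^n:|x|\le 2^k\}$, $A_k=B_k\setminus B_{k-1}$ and $\chi_k=\chi_{A_k}$ for $k\in\mathbb Z$. For $\vec q=(q_1,\dots,q_n)\in(1,\infty)^n$ the mixed Lebesgue space $L^{\vec q}(\mathbb R^n)$ is the set of measurable $f$ with $$\|f\|_{L^{\vec q}}=\Big(\int_{\mathbb R}\cdots\Big(\int_{\mathbb R}\Big(\int_{\mathbb R}|f(x_1,\dots,x_n)|^{q_1}\,dx_1\Big)^{q_2/q_1}dx_2\Big)^{q_3/q_2}\cdots\,dx_n\Big)^{1/q_n}<\infty,$$ $L^{\vec q}_{loc}$ is the set of measurable $f$ with $f\chi_K\in L^{\vec q}$ for every compact $K$, and $M\dot K^{\alpha,\lambda}_{p,\vec q}(\mathbb R^n)$ is the set of $f\in L^{\vec q}_{loc}$ with $$\|f\|_{M\dot K^{\alpha,\lambda}_{p,\vec q}}=\sup_{k_0\in\mathbb Z}2^{-k_0\lambda}\Big\{\sum_{k=-\infty}^{k_0}2^{k\alpha p}\|f\chi_k\|_{L^{\vec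 q}}^p\Big\}^{1/p}<\infty .$$ $BMO(\mathbb R^n)$ is the set of locally integrable $b$ with $\sup_B\frac1{|B|}\int_B|b-b_B|<\infty$, the supremum over all balls $B$, where $b_B=\frac1{|B|}\int_B b$. Let $D$ be a linear space of functions that contains all integrable functions with compact support. An operator $T$, sending functions to functions, is sublinear on $D$ if $|T(g+h)|\le|Tg|+|Th|$ and $|T(cg)|=|c||Tg|$ for all $g,h\in D$ and scalars $c$, at almost every point, where the exceptional null set can be chosen uniformly for $g,h$ in the span of finitely many elements of $D$ and all $c$. The commutator of $T$ with a function $b$ is $$[b,T]f(x)=T\big((b(x)-b(\cdot))f\big)(x)\qquad\text{for } f \text{ with } f\in D \text{ and } bf\in D$$ (so $[b,T]f=b\,Tf-T(bf)$ if $T$ is linear). **Corollary 4.1.** Let $0\le\lambda<\infty$, $0<p<\infty$, $1<q_i<\infty$ for $i=1,\dots,n$, $$\lambda-\sum_{i=1}^n\frac1{q_i}<\alpha<n-\sum_{i=1}^n\frac1{q_i},$$ and let $b\in BMO(\mathbb R^n)$. Let $T$ be sublinear on $D$, and suppose that there is a constant $C$ such that for every integrable $f$ with compact support $$|Tf(x)|\le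 C\int_{\mathbb R^n}\frac{|f(y)|}{|x-y|^n}\,dy\qquad\text{for almost every }x\notin\operatorname{supp}f .$$ Suppose that $[b,T]$ is bounded on $L^{\vec q}(\mathbb R^n)$: there is a constant $A$ such that $[b,T]f\in L^{\vec q}$ and $\|[b,T]f\|_{L^{\vec q}}\le A\|f\|_{L^{\vec q}}$ for all $f\in L^{\vec q}$ with $f,bf\in D$. Then $[b,T]$ is bounded on $M\dot K^{\alpha,\lambda}_{p,\vec q}(\mathbb R^n)$, in the following sense. There are an operator $S$ on $M\dot K^{\alpha,\lambda}_{p,\vec q}$ and a constant $C'$ such that 1. $Sf\in M\dot K^{\alpha,\lambda}_{p,\vec q}$ and $\|Sf\|_{M\dot K^{\alpha,\lambda}_{p,\vec q}}\le C'\|f\|_{M\dot K^{\alpha,\lambda}_{p,\vec q}}$ for all $f\in M\dot K^{\alpha,\lambda}_{p,\vec q}$; 2. $Sf=[b,T]f$ for all $f\in M\dot K^{\alpha,\lambda}_{p,\vec q}\cap L^{\vec q}$ with $f,bf\in D$; 3. for every $f\in M\dot K^{\alpha,\lambda}_{p,\vec q}$, $\big|[b,T](f\chi_{B_N})\big|\to|Sf|$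 almost everywhere as $N\to\infty$. -/

import Mathlib

open MeasureTheory Filter Topology
open scoped ENNReal NNReal

namespace HerzMorrey

/-- Iterated integral defining the mixed Lebesgue norm for finite positive exponents, for a
nonnegative function of `n` real variables: the first variable is integrated first (innermost,
exponent `q 0`) and the last variable is integrated last (outermost). -/
noncomputable def iteratedNorm :
    (n : ℕ) → (Fin n → ℝ) → ((Fin n → ℝ) → ℝ≥0∞) → ℝ≥0∞
  | 0, _, F => F Fin.elim0
  | n + 1, q, F =>
      (∫⁻ t : ℝ, (iteratedNorm n (fun i => q i.castSucc)
        (fun x => F (Fin.snoc x t))) ^ (q (Fin.last n))) ^ (1 / q (Fin.last n))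

variable {𝕜 : Type*} [RCLike 𝕜] {n : ℕ}

/-- The norm of `f` in the mixed Lebesgue space with exponents `q`, with values in `[0, ∞]`. -/
noncomputable def mixedNorm (q : Fin n → ℝ) (f : EuclideanSpace ℝ (Fin n) → 𝕜) : ℝ≥0∞ :=
  iteratedNorm n q (fun x => ‖f (WithLp.toLp 2 x)‖ₑ)

/-- Membership in the mixed Lebesgue space. -/
def MemMixedLp (q : Fin n → ℝ) (f : EuclideanSpace ℝ (Fin n) → 𝕜) : Prop :=
  AEStronglyMeasurable f volume ∧ mixedNorm q f < ∞

/-- Membership in the local mixed Lebesgue space. -/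
def MemMixedLpLoc (q : Fin n → ℝ) (f : EuclideanSpace ℝ (Fin n) → 𝕜) : Prop :=
  AEStronglyMeasurable f volume ∧
    ∀ K : Set (EuclideanSpace ℝ (Fin n)), IsCompact K → mixedNorm q (K.indicator f) < ∞

/-- The dyadic ball `B_k = {x : |x| ≤ 2 ^ k}`. -/
def dyadicBall (n : ℕ) (k : ℤ) : Set (EuclideanSpace ℝ (Fin n)) :=
  {x | ‖x‖ ≤ (2 : ℝ) ^ k}

/-- The dyadic annulus `A_k = B_k \ B_{k-1}`. -/
def annulus (n : ℕ) (k : ℤ) : Set (EuclideanSpace ℝ (Fin n)) :=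
  dyadicBall n k \ dyadicBall n (k - 1)

/-- The homogeneous mixed Herz-Morrey (quasi-)norm, with values in `[0, ∞]`. -/
noncomputable def herzMorreyNorm (α lam p : ℝ) (q : Fin n → ℝ)
    (f : EuclideanSpace ℝ (Fin n) → 𝕜) : ℝ≥0∞ :=
  ⨆ k₀ : ℤ, (2 : ℝ≥0∞) ^ (-(k₀ : ℝ) * lam) *
    (∑' k : Set.Iic k₀, (2 : ℝ≥0∞) ^ (((k : ℤ) : ℝ) * α * p) *
      (mixedNorm q ((annulus n (k : ℤ)).indicator f)) ^ p) ^ (1 / p)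

/-- Membership in the homogeneous mixed Herz-Morrey space. -/
def MemHerzMorrey (α lam p : ℝ) (q : Fin n → ℝ) (f : EuclideanSpace ℝ (Fin n) → 𝕜) : Prop :=
  MemMixedLpLoc q f ∧ herzMorreyNorm α lam p q f < ∞

/-- Bounded mean oscillation: locally integrable with bounded mean oscillation over balls. -/
def MemBMO (b : EuclideanSpace ℝ (Fin n) → 𝕜) : Prop :=
  LocallyIntegrable b volume ∧
    ∃ M : ℝ, ∀ (z : EuclideanSpace ℝ (Fin n)) (r : ℝ), 0 < r →
      ⨍ x in Metric.ball z r, ‖b x - ⨍ y in Metric.ball z r, b y‖ ≤ M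

/-- `T` is sublinear on the linear space `D` of functions: `|T(g + h)| ≤ |T g| + |T h|` and
`|T(c g)| = |c| |T g|` almost everywhere. The exceptional null set is uniform over the span of
finitely many functions, so that `x ↦ T((b(x) - b) f)(x)`, which evaluates at `x` the image of
an `x`-dependent element of the span of `f` and `b f`, is meaningful. -/
def SublinearOn (D : Submodule 𝕜 (EuclideanSpace ℝ (Fin n) → 𝕜))
    (T : (EuclideanSpace ℝ (Fin n) → 𝕜) → EuclideanSpace ℝ (Fin n) → 𝕜) : Prop :=
  ∀ F : Set (EuclideanSpace ℝ (Fin n) → 𝕜), F.Finite → F ⊆ D →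
    ∀ᵐ x : EuclideanSpace ℝ (Fin n),
      (∀ g ∈ Submodule.span 𝕜 F, ∀ h ∈ Submodule.span 𝕜 F,
        ‖T (g + h) x‖ ≤ ‖T g x‖ + ‖T h x‖) ∧
      (∀ g ∈ Submodule.span 𝕜 F, ∀ c : 𝕜, ‖T (c • g) x‖ = ‖c‖ * ‖T g x‖)

/-- The size condition `|T f(x)| ≤ C ∫ |f(y)| / |x - y| ^ n dy` for integrable `f` with compact
support and almost every `x` outside the support of `f`, with `C` independent of `f` and `x`. -/
def SizeCondition
    (T : (EuclideanSpace ℝ (Fin n) → 𝕜) → EuclideanSpace ℝ (Fin n) → 𝕜) : Prop :=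
  ∃ C : ℝ≥0, ∀ f : EuclideanSpace ℝ (Fin n) → 𝕜, Integrable f volume → HasCompactSupport f →
    ∀ᵐ x : EuclideanSpace ℝ (Fin n), x ∉ tsupport f →
      ‖T f x‖ₑ ≤ (C : ℝ≥0∞) * ∫⁻ y, ‖f y‖ₑ / ‖x - y‖ₑ ^ n

/-- The commutator `[b, T] f(x) = T((b(x) - b) f)(x)`. It equals `b(x) T f(x) - T(b f)(x)` if `T`
is linear. -/
def commutator (b : EuclideanSpace ℝ (Fin n) → 𝕜)
    (T : (EuclideanSpace ℝ (Fin n) → 𝕜) → EuclideanSpace ℝ (Fin n) → 𝕜)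
    (f : EuclideanSpace ℝ (Fin n) → 𝕜) : EuclideanSpace ℝ (Fin n) → 𝕜 :=
  fun x => T (fun y => (b x - b y) * f y) x

/-- The domain of the commutator of `b` with an operator defined on `D`. -/
def commutatorDomain (D : Submodule 𝕜 (EuclideanSpace ℝ (Fin n) → 𝕜))
    (b : EuclideanSpace ℝ (Fin n) → 𝕜) : Set (EuclideanSpace ℝ (Fin n) → 𝕜) :=
  {f | f ∈ D ∧ (fun y => b y * f y) ∈ D}

/-- The operator `S` with domain `dom` is bounded on the mixed Lebesgue space. -/
def BoundedOnMixedLp (q : Fin n → ℝ) (dom : Set (EuclideanSpace ℝ (Fin n) → 𝕜))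
    (S : (EuclideanSpace ℝ (Fin n) → 𝕜) → EuclideanSpace ℝ (Fin n) → 𝕜) : Prop :=
  ∃ A : ℝ≥0, ∀ f ∈ dom, MemMixedLp q f →
    MemMixedLp q (S f) ∧ mixedNorm q (S f) ≤ (A : ℝ≥0∞) * mixedNorm q f

/-- The operator `S`, defined on the whole homogeneous mixed Herz-Morrey space, is bounded on
it. -/
def BoundedOnHerzMorrey (α lam p : ℝ) (q : Fin n → ℝ)
    (S : (EuclideanSpace ℝ (Fin n) → 𝕜) → EuclideanSpace ℝ (Fin n) → 𝕜) : Prop :=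
  ∃ C : ℝ≥0, ∀ f, MemHerzMorrey α lam p q f →
    MemHerzMorrey α lam p q (S f) ∧
      herzMorreyNorm α lam p q (S f) ≤ (C : ℝ≥0∞) * herzMorreyNorm α lam p q f

end HerzMorrey

namespace HerzMorrey

/-! ### Iterated norms of nonnegative functions -/

/-! Write Q for the sum of the 1 / q_i and f_j for the restriction of f to the annulus A_j. The
proof compares the commutator on A_k with a weighted sum of the norms of all f_j.

Let x lie in A_k and split a truncation of f into a near part on B_{k+1} \ B_{k-2} and a far part.
The near part no longer depends on the truncation once the truncation is large, and boundedness on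
the mixed Lebesgue space handles it. For the far part the size condition passes to the commutator
with kernel |b(x) - b(y)| / |x - y|^n (`SublinearOn.enorm_commutator_le`), and |x - y| ≥ 2^(max(j,k)
- 2) for y in the far part of A_j. Hölder's inequality for mixed norms, the John–Nirenberg
inequality and the linear growth in |k - j| of the difference of the means of b over B_k and B_j
bound the contribution of A_j (`MemBMO.exists_lintegral_kernel_le`). Taking the norm in x over A_k
gives a constant times ∑_j w(k - j) ‖f_j‖ with w(m) = (1 + |m|) 2^(mQ - n max(m,0)).

A shift by m costs 2^(m(α - λ)) in the Morrey sequence norm. Since λ ≥ 0, the conditions λ - Q < α <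
n - Q make w(m) 2^(m(α - λ)) decay exponentially in both directions, so convolution with w is
bounded for every p > 0, including p < 1 (`exists_morreySeqNorm_convolution_le`).

A function of the Herz–Morrey space need not lie in the mixed Lebesgue space or in the domain of the
commutator, so an extension is needed. The same kernel bound shows that the absolute values of the
commutator along the truncations are Cauchy almost everywhere, because their differences are
controlled by tails of a convergent integral (`exists_tendsto_norm_commutator`). Sublinearity
controls absolute values only, hence the extension is this limit, except on the domain inside the
mixed Lebesgue space. There the commutator itself is kept, and Fatou's lemma identifies its absolute
value with the limit (`tendsto_norm_commutator_of_memMixedLp`). -/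

theorem measurable_snoc_prod (n : ℕ) :
    Measurable (fun z : ℝ × (Fin n → ℝ) => (Fin.snoc z.2 z.1 : Fin (n + 1) → ℝ)) := by
  rw [measurable_pi_iff]
  intro i
  refine Fin.lastCases ?_ (fun j => ?_) i
  · simpa using measurable_fst
  · have : Measurable (fun z : ℝ × (Fin n → ℝ) => z.2 j) :=
      (measurable_pi_apply j).comp measurable_snd
    simpa using this

theorem measurePreserving_snoc (n : ℕ) :
    MeasurePreserving (fun z : ℝ × (Fin n → ℝ) => (Fin.snoc z.2 z.1 : Fin (n + 1) → ℝ))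
      (volume.prod volume) volume := by
  have h := (volume_preserving_piFinSuccAbove (fun _ : Fin (n + 1) => ℝ) (Fin.last n)).symm
  have e : (fun z : ℝ × (Fin n → ℝ) => (Fin.snoc z.2 z.1 : Fin (n + 1) → ℝ)) =
      (MeasurableEquiv.piFinSuccAbove (fun _ : Fin (n + 1) => ℝ) (Fin.last n)).symm := by
    funext z
    rw [MeasurableEquiv.piFinSuccAbove_symm_apply]
    simp [Fin.insertNthEquiv]
  rw [e]
  exact h

theorem lintegral_eq_lintegral_snoc {n : ℕ} {F : (Fin (n + 1) → ℝ) → ℝ≥0∞} (hF : Measurable F) :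
    ∫⁻ x, F x = ∫⁻ t : ℝ, ∫⁻ x : Fin n → ℝ, F (Fin.snoc x t) := by
  rw [← (measurePreserving_snoc n).lintegral_comp hF, lintegral_prod]
  exact (hF.comp (measurable_snoc_prod n)).aemeasurable

theorem ae_ae_snoc {n : ℕ} {P : (Fin (n + 1) → ℝ) → Prop} (h : ∀ᵐ x, P x) :
    ∀ᵐ t : ℝ, ∀ᵐ x : Fin n → ℝ, P (Fin.snoc x t) :=
  Measure.ae_ae_of_ae_prod ((measurePreserving_snoc n).quasiMeasurePreserving.ae h)

/-- The parameter space is arbitrary so that the induction can absorb the outermost variable into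
it, passing from `Y` to `Y × ℝ`. -/
theorem measurable_iteratedNorm_param {n : ℕ} {q : Fin n → ℝ} {Y : Type*} [MeasurableSpace Y]
    {F : Y → (Fin n → ℝ) → ℝ≥0∞} (hF : Measurable (Function.uncurry F)) :
    Measurable (fun y => iteratedNorm n q (F y)) := by
  induction n generalizing Y with
  | zero => exact hF.comp (measurable_id.prodMk measurable_const)
  | succ n ih =>
    simp only [iteratedNorm]
    refine Measurable.pow_const (Measurable.lintegral_prod_right' (f := fun z : Y × ℝ =>
      (iteratedNorm n (fun i => q i.castSucc) (fun x => F z.1 (Fin.snoc x z.2))) ^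
        (q (Fin.last n))) ?_) _
    refine Measurable.pow_const (ih (Y := Y × ℝ)
      (F := fun z x => F z.1 (Fin.snoc x z.2)) ?_) _
    exact hF.comp ((measurable_fst.comp measurable_fst).prodMk
      ((measurable_snoc_prod n).comp ((measurable_snd.comp measurable_fst).prodMk measurable_snd)))

theorem measurable_iteratedNorm_snoc {n : ℕ} {q : Fin n → ℝ} {F : (Fin (n + 1) → ℝ) → ℝ≥0∞}
    (hF : Measurable F) :
    Measurable (fun t : ℝ => iteratedNorm n q (fun x => F (Fin.snoc x t))) :=
  measurable_iteratedNorm_param (F := fun t x => F (Fin.snoc x t))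
    (hF.comp (measurable_snoc_prod n))

theorem measurable_comp_snoc {n : ℕ} {F : (Fin (n + 1) → ℝ) → ℝ≥0∞} (hF : Measurable F) (t : ℝ) :
    Measurable (fun x : Fin n → ℝ => F (Fin.snoc x t)) :=
  hF.comp ((measurable_snoc_prod n).comp (measurable_const.prodMk measurable_id))

/-- By Fubini, almost every slice of a null set is null. In dimension zero the measure is a point
mass, so almost everywhere means everywhere. -/
theorem iteratedNorm_mono_ae {n : ℕ} {q : Fin n → ℝ} (hq : ∀ i, 1 < q i)
    {F G : (Fin n → ℝ) → ℝ≥0∞} (h : ∀ᵐ x, F x ≤ G x) :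
    iteratedNorm n q F ≤ iteratedNorm n q G := by
  induction n with
  | zero =>
    obtain ⟨x, hx⟩ := h.exists
    simpa [iteratedNorm, Subsingleton.elim x Fin.elim0] using hx
  | succ n ih =>
    have h0 : 0 ≤ q (Fin.last n) := by linarith [hq (Fin.last n)]
    refine ENNReal.rpow_le_rpow (lintegral_mono_ae ?_) (by positivity)
    filter_upwards [ae_ae_snoc h] with t ht
    exact ENNReal.rpow_le_rpow (ih (fun i => hq _) ht) h0

theorem iteratedNorm_const_mul {n : ℕ} {q : Fin n → ℝ} (hq : ∀ i, 1 < q i)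
    {c : ℝ≥0∞} (hc : c ≠ ∞) (F : (Fin n → ℝ) → ℝ≥0∞) :
    iteratedNorm n q (fun x => c * F x) = c * iteratedNorm n q F := by
  induction n with
  | zero => rfl
  | succ n ih =>
    have h0 : 0 < q (Fin.last n) := by linarith [hq (Fin.last n)]
    simp only [iteratedNorm]
    simp_rw [ih (fun i => hq _), ENNReal.mul_rpow_of_nonneg _ _ h0.le]
    rw [lintegral_const_mul' _ _ (ENNReal.rpow_ne_top_of_nonneg h0.le hc),
      ENNReal.mul_rpow_of_nonneg _ _ (by positivity), ← ENNReal.rpow_mul,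
      mul_one_div_cancel h0.ne', ENNReal.rpow_one]

theorem iteratedNorm_add_le {n : ℕ} {q : Fin n → ℝ} (hq : ∀ i, 1 < q i)
    {F G : (Fin n → ℝ) → ℝ≥0∞} (hF : Measurable F) (hG : Measurable G) :
    iteratedNorm n q (fun x => F x + G x) ≤ iteratedNorm n q F + iteratedNorm n q G := by
  induction n with
  | zero => rfl
  | succ n ih =>
    have h0 : 0 < q (Fin.last n) := by linarith [hq (Fin.last n)]
    simp only [iteratedNorm]
    refine le_trans ?_ (ENNReal.lintegral_Lp_add_le
      (measurable_iteratedNorm_snoc hF).aemeasurable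
      (measurable_iteratedNorm_snoc hG).aemeasurable (hq (Fin.last n)).le)
    refine ENNReal.rpow_le_rpow (lintegral_mono fun t => ?_) (by positivity)
    exact ENNReal.rpow_le_rpow (ih (fun i => hq _) (measurable_comp_snoc hF t)
      (measurable_comp_snoc hG t)) h0.le

theorem lintegral_fin_zero (F : (Fin 0 → ℝ) → ℝ≥0∞) : ∫⁻ x, F x = F Fin.elim0 := by
  rw [volume_pi, Measure.pi_of_empty _ Fin.elim0, lintegral_dirac]

/-- Hölder's inequality for iterated norms. -/
theorem lintegral_mul_le_iteratedNorm {n : ℕ} {q q' : Fin n → ℝ}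
    (hq : ∀ i, (q i).HolderConjugate (q' i))
    {F G : (Fin n → ℝ) → ℝ≥0∞} (hF : Measurable F) (hG : Measurable G) :
    ∫⁻ x, F x * G x ≤ iteratedNorm n q F * iteratedNorm n q' G := by
  induction n with
  | zero => rw [lintegral_fin_zero]; rfl
  | succ n ih =>
    rw [lintegral_eq_lintegral_snoc (F := fun x => F x * G x) (hF.mul hG)]
    simp only [iteratedNorm]
    refine le_trans (lintegral_mono fun t => ih (fun i => hq i.castSucc)
      (measurable_comp_snoc hF t) (measurable_comp_snoc hG t)) ?_
    exact ENNReal.lintegral_mul_le_Lp_mul_Lq volume (hq (Fin.last n))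
      (measurable_iteratedNorm_snoc hF).aemeasurable
      (measurable_iteratedNorm_snoc hG).aemeasurable

/-- Embedding of a Lebesgue space into the mixed spaces of smaller exponents, for functions
supported in a cube. -/
theorem iteratedNorm_le_of_support {n : ℕ} {q : Fin n → ℝ} (hq : ∀ i, 1 < q i) {r : ℝ}
    (hr : 0 < r) (hqr : ∀ i, q i < r) {s : Set ℝ} (hs : MeasurableSet s)
    (hs0 : volume s ≠ 0) (hs1 : volume s ≠ ∞)
    {F : (Fin n → ℝ) → ℝ≥0∞} (hF : Measurable F) (hsupp : ∀ x, (∃ i, x i ∉ s) → F x = 0) :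
    iteratedNorm n q F ≤
      volume s ^ (∑ i, (1 / q i - 1 / r)) * (∫⁻ x, F x ^ r) ^ (1 / r) := by
  induction n with
  | zero =>
    rw [lintegral_fin_zero, ← ENNReal.rpow_mul, mul_one_div_cancel hr.ne']
    simp [iteratedNorm]
  | succ n ih =>
    have h0 : 0 < q (Fin.last n) := by linarith [hq (Fin.last n)]
    have hrl := hqr (Fin.last n)
    set a := q (Fin.last n) with ha
    have hd : 0 < 1 / a - 1 / r := by
      rw [sub_pos]; exact one_div_lt_one_div_of_lt h0 hrl
    have hqi : ∀ i : Fin n, 1 < q i.castSucc := fun i => hq _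
    set H : ℝ → ℝ≥0∞ := fun t => iteratedNorm n (fun i => q i.castSucc)
      (fun x => F (Fin.snoc x t)) with hH
    have hHm : Measurable H := measurable_iteratedNorm_snoc hF
    set V : ℝ≥0∞ := volume s ^ (∑ i : Fin n, (1 / q i.castSucc - 1 / r)) with hV
    have hVtop : V ≠ ∞ := ENNReal.rpow_ne_top_of_ne_zero hs0 hs1
    have hHle : ∀ t, H t ≤ V * (∫⁻ x : Fin n → ℝ, F (Fin.snoc x t) ^ r) ^ (1 / r) := fun t =>
      ih hqi (fun i => hqr _) (measurable_comp_snoc hF t) (fun x ⟨i, hi⟩ =>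
        hsupp _ ⟨i.castSucc, by simpa using hi⟩)
    -- The slice norm vanishes off `s`. With the indicator as a second factor, Hölder with 1/a = 1/r
    -- + (1/a - 1/r) gains the power of the measure of `s`.
    have hHs : ∀ t, H t = H t * s.indicator 1 t := by
      intro t
      by_cases ht : t ∈ s
      · simp [ht]
      · have : ∀ x : Fin n → ℝ, F (Fin.snoc x t) = 0 := fun x =>
          hsupp _ ⟨Fin.last n, by simpa using ht⟩
        have h2 := hHle t
        simp only [this, ENNReal.zero_rpow_of_pos hr, lintegral_zero,
          ENNReal.zero_rpow_of_pos (one_div_pos.2 hr), mul_zero] at h2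
        simp [ht, nonpos_iff_eq_zero.1 h2]
    have step : (∫⁻ t, H t ^ a) ^ (1 / a) ≤
        (∫⁻ t, H t ^ r) ^ (1 / r) * volume s ^ (1 / a - 1 / r) := by
      have h1 := ENNReal.lintegral_Lp_mul_le_Lq_mul_Lr (p := a) (q := r)
        (r := 1 / (1 / a - 1 / r)) h0 hrl (by rw [one_div_one_div]; ring) volume
        hHm.aemeasurable
        ((measurable_const (a := (1 : ℝ≥0∞))).indicator hs).aemeasurable
      have h2 : ∀ t, (s.indicator (fun _ => (1 : ℝ≥0∞)) t) ^ (1 / (1 / a - 1 / r)) =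
          s.indicator 1 t := by
        intro t
        by_cases ht : t ∈ s
        · simp [ht]
        · simp only [ht, not_false_eq_true, Set.indicator_of_notMem]
          exact ENNReal.zero_rpow_of_pos (one_div_pos.2 hd)
      simp_rw [h2, one_div_one_div, lintegral_indicator_one hs] at h1
      refine le_trans (le_of_eq ?_) h1
      congr 1
      refine lintegral_congr fun t => ?_
      rw [hHs t]; rfl
    have step2 : (∫⁻ t, H t ^ r) ^ (1 / r) ≤ V * (∫⁻ x, F x ^ r) ^ (1 / r) := by
      rw [lintegral_eq_lintegral_snoc (hF.pow_const r)]
      calc (∫⁻ t, H t ^ r) ^ (1 / r)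
          ≤ (∫⁻ t, V ^ r * ∫⁻ x : Fin n → ℝ, F (Fin.snoc x t) ^ r) ^ (1 / r) := by
            refine ENNReal.rpow_le_rpow (lintegral_mono fun t => ?_) (by positivity)
            refine le_trans (ENNReal.rpow_le_rpow (hHle t) hr.le) (le_of_eq ?_)
            rw [ENNReal.mul_rpow_of_nonneg _ _ hr.le, ← ENNReal.rpow_mul (∫⁻ x : Fin n → ℝ, _),
              one_div_mul_cancel hr.ne', ENNReal.rpow_one]
        _ = _ := by
            rw [lintegral_const_mul' _ _ (ENNReal.rpow_ne_top_of_nonneg hr.le hVtop),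
              ENNReal.mul_rpow_of_nonneg _ _ (by positivity), ← ENNReal.rpow_mul,
              mul_one_div_cancel hr.ne', ENNReal.rpow_one]
    calc iteratedNorm (n + 1) q F = (∫⁻ t, H t ^ a) ^ (1 / a) := rfl
      _ ≤ _ := step
      _ ≤ (V * (∫⁻ x, F x ^ r) ^ (1 / r)) * volume s ^ (1 / a - 1 / r) := by gcongr
      _ = _ := by
        rw [Fin.sum_univ_castSucc, ENNReal.rpow_add _ _ hs0 hs1, hV]
        ring

/-- Dominated convergence for iterated norms. -/
theorem tendsto_iteratedNorm_zero {n : ℕ} {q : Fin n → ℝ} (hq : ∀ i, 1 < q i)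
    {F : ℕ → (Fin n → ℝ) → ℝ≥0∞} {G : (Fin n → ℝ) → ℝ≥0∞} (hF : ∀ N, Measurable (F N))
    (hG : Measurable G) (hFG : ∀ N x, F N x ≤ G x) (hfin : iteratedNorm n q G ≠ ∞)
    (hlim : ∀ x, Tendsto (fun N => F N x) atTop (𝓝 0)) :
    Tendsto (fun N => iteratedNorm n q (F N)) atTop (𝓝 0) := by
  induction n with
  | zero => exact hlim _
  | succ n ih =>
    have h0 : 0 < q (Fin.last n) := by linarith [hq (Fin.last n)]
    have hqi : ∀ i : Fin n, 1 < q i.castSucc := fun i => hq _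
    simp only [iteratedNorm] at hfin ⊢
    have hfin' : ∫⁻ t : ℝ, (iteratedNorm n (fun i => q i.castSucc)
        (fun x => G (Fin.snoc x t))) ^ (q (Fin.last n)) ≠ ∞ := by
      intro h
      rw [h, ENNReal.top_rpow_of_pos (one_div_pos.2 h0)] at hfin
      exact hfin rfl
    have key := tendsto_lintegral_of_dominated_convergence
      (F := fun N t => (iteratedNorm n (fun i => q i.castSucc)
        (fun x => F N (Fin.snoc x t))) ^ (q (Fin.last n))) (f := fun _ => 0) _
      (fun N => (measurable_iteratedNorm_snoc (hF N)).pow_const _)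
      (fun N => ae_of_all _ fun t => ENNReal.rpow_le_rpow
        (iteratedNorm_mono_ae hqi (ae_of_all _ fun x => hFG N (Fin.snoc x t))) h0.le) hfin' ?_
    · rw [lintegral_zero] at key
      have := key.ennrpow_const (1 / q (Fin.last n))
      rwa [ENNReal.zero_rpow_of_pos (one_div_pos.2 h0)] at this
    -- Finiteness of the outer integral makes the inner norm of `G` finite for almost every `t`, as
    -- the induction hypothesis requires.
    · filter_upwards [ae_lt_top ((measurable_iteratedNorm_snoc hG).pow_const _) hfin'] with t ht
      have ht' : iteratedNorm n (fun i => q i.castSucc) (fun x => G (Fin.snoc x t)) ≠ ∞ := by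
        intro h
        rw [h, ENNReal.top_rpow_of_pos h0] at ht
        exact lt_irrefl _ ht
      have := (ih hqi (fun N => measurable_comp_snoc (hF N) t) (measurable_comp_snoc hG t)
        (fun N x => hFG N _) ht' (fun x => hlim _)).ennrpow_const (q (Fin.last n))
      rwa [ENNReal.zero_rpow_of_pos h0] at this

/-! ### The mixed norm of nonnegative functions on Euclidean space -/

/-- The mixed norm of a nonnegative function on Euclidean space. -/
noncomputable def mixedENorm {n : ℕ} (q : Fin n → ℝ) (G : EuclideanSpace ℝ (Fin n) → ℝ≥0∞) :
    ℝ≥0∞ :=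
  iteratedNorm n q (fun x => G (WithLp.toLp 2 x))

section MixedENorm

variable {n : ℕ} {q : Fin n → ℝ} {F G : EuclideanSpace ℝ (Fin n) → ℝ≥0∞}

theorem measurePreserving_toLp (n : ℕ) :
    MeasurePreserving (WithLp.toLp 2 : (Fin n → ℝ) → EuclideanSpace ℝ (Fin n)) :=
  PiLp.volume_preserving_toLp (Fin n)

theorem mixedENorm_mono_ae (hq : ∀ i, 1 < q i) (h : ∀ᵐ x, F x ≤ G x) :
    mixedENorm q F ≤ mixedENorm q G :=
  iteratedNorm_mono_ae hq ((measurePreserving_toLp n).quasiMeasurePreserving.ae h)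

theorem mixedENorm_mono (hq : ∀ i, 1 < q i) (h : ∀ x, F x ≤ G x) :
    mixedENorm q F ≤ mixedENorm q G :=
  mixedENorm_mono_ae hq (ae_of_all _ h)

theorem mixedENorm_congr_ae (hq : ∀ i, 1 < q i) (h : F =ᵐ[volume] G) :
    mixedENorm q F = mixedENorm q G :=
  le_antisymm (mixedENorm_mono_ae hq h.le) (mixedENorm_mono_ae hq h.symm.le)

theorem mixedENorm_const_mul (hq : ∀ i, 1 < q i) {c : ℝ≥0∞} (hc : c ≠ ∞) :
    mixedENorm q (fun x => c * F x) = c * mixedENorm q F :=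
  iteratedNorm_const_mul hq hc _

theorem mixedENorm_add_le (hq : ∀ i, 1 < q i) (hF : AEMeasurable F) (hG : AEMeasurable G) :
    mixedENorm q (fun x => F x + G x) ≤ mixedENorm q F + mixedENorm q G := by
  change mixedENorm q (F + G) ≤ _
  rw [mixedENorm_congr_ae hq hF.ae_eq_mk, mixedENorm_congr_ae hq hG.ae_eq_mk,
    mixedENorm_congr_ae hq (hF.ae_eq_mk.add hG.ae_eq_mk)]
  exact iteratedNorm_add_le hq (hF.measurable_mk.comp (measurePreserving_toLp n).measurable)
    (hG.measurable_mk.comp (measurePreserving_toLp n).measurable)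

theorem lintegral_mul_le_mixedENorm {q' : Fin n → ℝ} (hq : ∀ i, (q i).HolderConjugate (q' i))
    (hF : AEMeasurable F) (hG : AEMeasurable G) :
    ∫⁻ x, F x * G x ≤ mixedENorm q F * mixedENorm q' G := by
  change ∫⁻ x, (F * G) x ≤ _
  rw [mixedENorm_congr_ae (fun i => (hq i).lt) hF.ae_eq_mk,
    mixedENorm_congr_ae (fun i => (hq i).symm.lt) hG.ae_eq_mk,
    lintegral_congr_ae (hF.ae_eq_mk.mul hG.ae_eq_mk)]
  rw [← (measurePreserving_toLp n).lintegral_comp (hF.measurable_mk.mul hG.measurable_mk)]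
  exact lintegral_mul_le_iteratedNorm hq
    (hF.measurable_mk.comp (measurePreserving_toLp n).measurable)
    (hG.measurable_mk.comp (measurePreserving_toLp n).measurable)

/-- The ball of radius `l` lies in the cube of side `2 * l`, whose sides give the powers of the
measure. -/
theorem mixedENorm_indicator_closedBall_le (hq : ∀ i, 1 < q i) {r : ℝ}
    (hr : 0 < r) (hqr : ∀ i, q i < r) {l : ℝ} (hl : 0 < l) (hF : AEMeasurable F) :
    mixedENorm q ((Metric.closedBall 0 l).indicator F) ≤
      ENNReal.ofReal (2 * l) ^ (∑ i, (1 / q i - 1 / r)) *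
        (∫⁻ x in Metric.closedBall 0 l, F x ^ r) ^ (1 / r) := by
  have hB : MeasurableSet (Metric.closedBall (0 : EuclideanSpace ℝ (Fin n)) l) :=
    measurableSet_closedBall
  have hvol : volume (Set.Icc (-l) l) = ENNReal.ofReal (2 * l) := by
    rw [Real.volume_Icc]; ring_nf
  have hae : (Metric.closedBall 0 l).indicator F =ᵐ[volume]
      (Metric.closedBall 0 l).indicator (hF.mk F) := by
    filter_upwards [hF.ae_eq_mk] with x hx
    simp only [Set.indicator, hx]
  have hm : Measurable ((Metric.closedBall 0 l).indicator (hF.mk F)) :=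
    hF.measurable_mk.indicator hB
  rw [mixedENorm_congr_ae hq hae]
  have key := iteratedNorm_le_of_support hq hr hqr (s := Set.Icc (-l) l) measurableSet_Icc
    (by rw [hvol]; simpa using hl) (by rw [hvol]; exact ENNReal.ofReal_ne_top)
    (hm.comp (measurePreserving_toLp n).measurable) (fun x ⟨i, hi⟩ => by
      refine Set.indicator_of_notMem (fun hx => hi ?_) _
      rw [mem_closedBall_zero_iff] at hx
      have := PiLp.norm_apply_le (WithLp.toLp 2 x) i
      rw [Real.norm_eq_abs] at this
      exact abs_le.1 (this.trans hx))
  refine key.trans (le_of_eq ?_)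
  rw [hvol]
  congr 2
  have h2 := (measurePreserving_toLp n).lintegral_comp (hm.pow_const r)
  refine h2.trans ?_
  rw [← lintegral_indicator hB]
  refine lintegral_congr_ae ?_
  filter_upwards [hF.ae_eq_mk] with x hx
  by_cases hxB : x ∈ Metric.closedBall (0 : EuclideanSpace ℝ (Fin n)) l
  · simp only [hxB, Set.indicator_of_mem, hx]
  · simp only [hxB, not_false_eq_true, Set.indicator_of_notMem, ENNReal.zero_rpow_of_pos hr]

theorem tendsto_mixedENorm_indicator_zero (hq : ∀ i, 1 < q i) (hF : AEMeasurable F)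
    (hfin : mixedENorm q F ≠ ∞) {s : ℕ → Set (EuclideanSpace ℝ (Fin n))}
    (hs : ∀ N, MeasurableSet (s N)) (hlim : ∀ x, ∀ᶠ N in atTop, x ∉ s N) :
    Tendsto (fun N => mixedENorm q ((s N).indicator F)) atTop (𝓝 0) := by
  have hae : ∀ N, (s N).indicator F =ᵐ[volume] (s N).indicator (hF.mk F) := fun N => by
    filter_upwards [hF.ae_eq_mk] with x hx
    simp only [Set.indicator, hx]
  simp_rw [fun N => mixedENorm_congr_ae hq (hae N)]
  rw [mixedENorm_congr_ae hq hF.ae_eq_mk] at hfin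
  refine tendsto_iteratedNorm_zero hq
    (fun N => (hF.measurable_mk.indicator (hs N)).comp (measurePreserving_toLp n).measurable)
    (hF.measurable_mk.comp (measurePreserving_toLp n).measurable)
    (fun N x => Set.indicator_le_self _ _ _) hfin (fun x => ?_)
  refine tendsto_const_nhds.congr' ?_
  filter_upwards [hlim (WithLp.toLp 2 x)] with N hN
  exact (Set.indicator_of_notMem hN _).symm

end MixedENorm

/-! ### The John–Nirenberg inequality on balls -/

set_option linter.unusedSectionVars false

section JohnNirenberg

variable {E : Type*} [NormedAddCommGroup E] [NormedSpace ℝ E] [FiniteDimensional ℝ E]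
  [MeasurableSpace E] [BorelSpace E] {μ : Measure E} [μ.IsAddHaarMeasure]
  {F : Type*} [NormedAddCommGroup F] [NormedSpace ℝ F]

theorem addHaar_ball_natCast_mul (x y : E) {N : ℕ} (hN : 0 < N) {r : ℝ} (hr : 0 < r) :
    μ (Metric.ball x (N * r)) = (N : ℝ≥0∞) ^ Module.finrank ℝ E * μ (Metric.ball y r) := by
  have hN' : (0 : ℝ) < N := by exact_mod_cast hN
  rw [Measure.addHaar_ball_of_pos μ x (mul_pos hN' hr), Measure.addHaar_ball_of_pos μ y hr,
    mul_pow, ENNReal.ofReal_mul (by positivity), mul_assoc, ENNReal.ofReal_pow hN'.le,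
    ENNReal.ofReal_natCast]

theorem addHaar_closedBall_eq_ball (x y : E) {r : ℝ} (hr : 0 < r) :
    μ (Metric.closedBall x r) = μ (Metric.ball y r) := by
  rw [Measure.addHaar_closedBall μ x hr.le, Measure.addHaar_ball_of_pos μ y hr]

theorem addHaar_ball_ne_zero (x : E) {r : ℝ} (hr : 0 < r) : μ (Metric.ball x r) ≠ 0 :=
  (Metric.measure_ball_pos μ x hr).ne'

theorem addHaar_ball_ne_top (x : E) (r : ℝ) : μ (Metric.ball x r) ≠ ∞ :=
  measure_ball_lt_top.ne

theorem integrableOn_ball_of_locallyIntegrable {b : E → F} (hb : LocallyIntegrable b μ) (x : E)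
    (r : ℝ) : IntegrableOn b (Metric.ball x r) μ :=
  (hb.integrableOn_isCompact (isCompact_closedBall x r)).mono_set Metric.ball_subset_closedBall

/-- The distance of the mean from a constant is at most the mean distance. -/
theorem enorm_setAverage_sub_le [CompleteSpace F] {b : E → F} {s : Set E} (hb : IntegrableOn b s μ)
    (h0 : μ s ≠ 0) (h1 : μ s ≠ ∞) (c : F) :
    ‖(⨍ y in s, b y ∂μ) - c‖ₑ * μ s ≤ ∫⁻ y in s, ‖b y - c‖ₑ ∂μ := by
  have hr : μ.real s ≠ 0 := by
    rw [Measure.real, Ne, ENNReal.toReal_eq_zero_iff]; tauto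
  have h2 : (⨍ y in s, b y ∂μ) - c = (μ.real s)⁻¹ • ∫ y in s, (b y - c) ∂μ := by
    rw [setAverage_eq, integral_sub hb (integrableOn_const h1), setIntegral_const, smul_sub,
      smul_smul, inv_mul_cancel₀ hr, one_smul]
  have h3 : ‖(μ.real s)⁻¹‖ₑ * μ s = 1 := by
    rw [enorm_inv hr, Real.enorm_eq_ofReal measureReal_nonneg, ofReal_measureReal h1,
      ENNReal.inv_mul_cancel h0 h1]
  rw [h2, enorm_smul, mul_assoc, mul_comm _ (μ s), ← mul_assoc, h3, one_mul]
  exact enorm_integral_le_lintegral_enorm _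

/-- Mean oscillation over balls is bounded by `M`. -/
def BallOscillationLE (μ : Measure E) (b : E → F) (M : ℝ≥0∞) : Prop :=
  ∀ (z : E) (r : ℝ), 0 < r → ∫⁻ x in Metric.ball z r, ‖b x - ⨍ y in Metric.ball z r, b y ∂μ‖ₑ ∂μ ≤
    M * μ (Metric.ball z r)

variable [CompleteSpace F] {b : E → F} {M : ℝ≥0∞}

/-- The means over a ball and over a larger ball are comparable. -/
theorem enorm_setAverage_ball_sub_le (hb : LocallyIntegrable b μ) (hM : BallOscillationLE μ b M)
    {z w : E} {N : ℕ} (hN : 0 < N) {r : ℝ} (hr : 0 < r)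
    (hsub : Metric.ball w r ⊆ Metric.ball z (N * r)) :
    ‖(⨍ y in Metric.ball w r, b y ∂μ) - ⨍ y in Metric.ball z (N * r), b y ∂μ‖ₑ ≤
      (N : ℝ≥0∞) ^ Module.finrank ℝ E * M := by
  have hN' : (0 : ℝ) < N := by exact_mod_cast hN
  have h0 := addHaar_ball_ne_zero (μ := μ) w hr
  have h1 := addHaar_ball_ne_top (μ := μ) w r
  have key := (enorm_setAverage_sub_le (integrableOn_ball_of_locallyIntegrable hb w r) h0 h1
    (⨍ y in Metric.ball z (N * r), b y ∂μ)).trans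
    ((lintegral_mono_set hsub).trans (hM z (N * r) (mul_pos hN' hr)))
  rw [addHaar_ball_natCast_mul z w hN hr, ← mul_assoc, mul_comm M] at key
  exact (ENNReal.mul_le_mul_iff_left h0 h1).1 key

/-- The stopping balls below have centres in the ball of radius `r` and radii at most `r`, so they
fill out only the doubled ball, while the mean stays that of the original one. -/
theorem lintegral_ball_two_mul_le (hb : LocallyIntegrable b μ) (hM : BallOscillationLE μ b M)
    (z : E) {r : ℝ} (hr : 0 < r) :
    ∫⁻ x in Metric.ball z (2 * r), ‖b x - ⨍ y in Metric.ball z r, b y ∂μ‖ₑ ∂μ ≤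
      ((1 + 2 ^ Module.finrank ℝ E) * 2 ^ Module.finrank ℝ E * M) * μ (Metric.ball z r) := by
  set d := Module.finrank ℝ E
  set c := ⨍ y in Metric.ball z r, b y ∂μ with hc
  set c2 := ⨍ y in Metric.ball z (2 * r), b y ∂μ with hc2
  have hv : μ (Metric.ball z (2 * r)) = 2 ^ d * μ (Metric.ball z r) := by
    exact_mod_cast addHaar_ball_natCast_mul (μ := μ) z z (N := 2) two_pos hr
  have hcc : ‖c2 - c‖ₑ ≤ 2 ^ d * M := by
    rw [← enorm_neg, neg_sub]
    exact_mod_cast enorm_setAverage_ball_sub_le hb hM (z := z) (w := z) (N := 2) two_pos hr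
      (Metric.ball_subset_ball (by push_cast; linarith))
  calc ∫⁻ x in Metric.ball z (2 * r), ‖b x - c‖ₑ ∂μ
      ≤ ∫⁻ x in Metric.ball z (2 * r), (‖b x - c2‖ₑ + ‖c2 - c‖ₑ) ∂μ := by
        refine lintegral_mono fun x => ?_
        have : b x - c = (b x - c2) + (c2 - c) := by abel
        rw [this]; exact enorm_add_le _ _
    _ = (∫⁻ x in Metric.ball z (2 * r), ‖b x - c2‖ₑ ∂μ) +
          ‖c2 - c‖ₑ * μ (Metric.ball z (2 * r)) := by
        rw [lintegral_add_right _ measurable_const, setLIntegral_const]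
    _ ≤ M * μ (Metric.ball z (2 * r)) + (2 ^ d * M) * μ (Metric.ball z (2 * r)) := by
        gcongr
        exact hM z (2 * r) (by positivity)
    _ = _ := by rw [hv]; ring

/-- Stopping radius: at a Lebesgue point where `‖b - c‖` is large there is a ball on which the mean
of `‖b - c‖` is large while it is not on the six times larger ball. -/
theorem exists_stopping_radius {h : E → ℝ} (h0 : ∀ x, 0 ≤ h x) (hh : LocallyIntegrable h μ)
    {K : ℝ≥0∞} {x : E} {R : ℝ} (hR : 0 < R)
    (hx : Tendsto (fun m : ℕ => ⨍ y in Metric.closedBall x (R * (1 / 6) ^ m), h y ∂μ) atTop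
      (𝓝 (h x)))
    (hKx : K < ENNReal.ofReal (h x))
    (hbig : ∫⁻ y in Metric.closedBall x R, ENNReal.ofReal (h y) ∂μ ≤
      K * μ (Metric.closedBall x R)) :
    ∃ ρ, 0 < ρ ∧ ρ ≤ R ∧
      K * μ (Metric.closedBall x ρ) < ∫⁻ y in Metric.closedBall x ρ, ENNReal.ofReal (h y) ∂μ ∧
      ∫⁻ y in Metric.ball x (6 * ρ), ENNReal.ofReal (h y) ∂μ ≤
        K * μ (Metric.ball x (6 * ρ)) := by
  -- The means over the shrinking balls tend to `h x`, which exceeds `K`, so some mean exceeds `K`.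
  have hpos : ∀ m : ℕ, 0 < R * (1 / 6 : ℝ) ^ m := fun m => by positivity
  have hex : ∃ m : ℕ, K * μ (Metric.closedBall x (R * (1 / 6) ^ m)) <
      ∫⁻ y in Metric.closedBall x (R * (1 / 6) ^ m), ENNReal.ofReal (h y) ∂μ := by
    have hx' := (ENNReal.tendsto_ofReal hx).eventually_const_lt hKx
    obtain ⟨m, hm⟩ := hx'.exists
    refine ⟨m, ?_⟩
    set S := Metric.closedBall x (R * (1 / 6 : ℝ) ^ m)
    have hS0 : μ S ≠ 0 := (Metric.measure_closedBall_pos μ x (hpos m)).ne'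
    have hS1 : μ S ≠ ∞ := measure_closedBall_lt_top.ne
    have hint : IntegrableOn h S μ := hh.integrableOn_isCompact (isCompact_closedBall _ _)
    rw [setAverage_eq, smul_eq_mul, ENNReal.ofReal_mul (by positivity),
      ofReal_integral_eq_lintegral_ofReal hint (ae_of_all _ h0),
      ENNReal.ofReal_inv_of_pos (by
        rw [Measure.real]; exact ENNReal.toReal_pos hS0 hS1), ofReal_measureReal hS1,
      mul_comm, ← div_eq_mul_inv] at hm
    exact (ENNReal.lt_div_iff_mul_lt (Or.inl hS0) (Or.inl hS1)).1 hm
  classical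
  -- The first such scale is not the initial one, by `hbig`. The preceding scale has six times the
  -- radius and mean at most `K`.
  set m := Nat.find hex with hm
  have hm1 := Nat.find_spec hex
  rw [← hm] at hm1
  have hm0 : m ≠ 0 := by
    intro h'
    rw [h', pow_zero, mul_one] at hm1
    exact absurd hbig (not_le.2 hm1)
  obtain ⟨k, hk⟩ := Nat.exists_eq_succ_of_ne_zero hm0
  have hk1 := not_lt.1 (Nat.find_min hex (m := k) (by omega))
  have h6 : R * (1 / 6 : ℝ) ^ k = 6 * (R * (1 / 6) ^ m) := by
    rw [hk, Nat.succ_eq_add_one, pow_succ]; ring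
  refine ⟨R * (1 / 6) ^ m, hpos m, ?_, hm1, ?_⟩
  · exact mul_le_of_le_one_right hR.le (pow_le_one₀ (by norm_num) (by norm_num))
  · rw [← h6, ← addHaar_closedBall_eq_ball x x (hpos k)]
    exact (lintegral_mono_set Metric.ball_subset_closedBall).trans hk1

/-- Distributional form of the oscillation on balls. -/
def BallDistributionLE (μ : Measure E) (b : E → F) (s t : ℝ≥0∞) : Prop :=
  ∀ (z : E) (r : ℝ), 0 < r →
    μ {x ∈ Metric.ball z r | s < ‖b x - ⨍ y in Metric.ball z r, b y ∂μ‖ₑ} ≤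
      t * μ (Metric.ball z r)

/-- A Calderón–Zygmund stopping argument with balls: raising the level by a fixed multiple of `M`
halves the measure of the exceptional set, because that set is covered by balls of small total
measure to which the hypothesis at level `s` applies again. -/
theorem BallDistributionLE.step (hb : LocallyIntegrable b μ) (hM : BallOscillationLE μ b M)
    (hM0 : M ≠ 0) (hM1 : M ≠ ∞) {s t : ℝ≥0∞} (h : BallDistributionLE μ b s t) :
    BallDistributionLE μ b
      (s + 2 * 6 ^ Module.finrank ℝ E *
        ((1 + 2 ^ Module.finrank ℝ E) * 2 ^ Module.finrank ℝ E * M)) (t * 2⁻¹) := by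
  intro z R hR
  set d := Module.finrank ℝ E with hd
  set L : ℝ≥0∞ := (1 + 2 ^ d) * 2 ^ d * M with hL
  set K : ℝ≥0∞ := 2 * 6 ^ d * L with hK
  set c := ⨍ y in Metric.ball z R, b y ∂μ with hc
  have hL0 : L ≠ 0 := by simp [hL, hM0]
  have hL1 : L ≠ ∞ := by
    simp only [hL]
    exact ENNReal.mul_ne_top (ENNReal.mul_ne_top (by simp) (by simp)) hM1
  have hK0 : K ≠ 0 := by simp [hK, hL0]
  have hK1 : K ≠ ∞ := ENNReal.mul_ne_top (ENNReal.mul_ne_top (by simp) (by simp)) hL1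
  have hLK : L ≤ K := by
    rw [hK]
    refine le_mul_of_one_le_left zero_le ?_
    exact one_le_mul (by norm_num) (one_le_pow₀ (by norm_num))
  have hlocc : LocallyIntegrable (fun y => ‖b y - c‖) μ :=
    fun x => ((hb.sub (locallyIntegrable_const c)) x).norm
  have henorm : ∀ y, ENNReal.ofReal ‖b y - c‖ = ‖b y - c‖ₑ := fun y => ofReal_norm _
  have hleb := IsUnifLocDoublingMeasure.ae_tendsto_average μ hlocc 1
  -- Points at which the means along the radii used in the stopping argument converge to the value;
  -- almost every point is one.
  set G : Set E := {x | Tendsto (fun m : ℕ =>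
    ⨍ y in Metric.closedBall x (R * (1 / 6) ^ m), ‖b y - c‖ ∂μ) atTop (𝓝 ‖b x - c‖)} with hG
  have hGae : ∀ᵐ x ∂μ, x ∈ G := by
    filter_upwards [hleb] with x hx
    refine hx (fun _ => x) (fun m : ℕ => R * (1 / 6) ^ m) ?_ (Eventually.of_forall fun m => ?_)
    · refine tendsto_nhdsWithin_iff.2 ⟨?_, Eventually.of_forall fun m => by
        simp only [Set.mem_Ioi]; positivity⟩
      have := (tendsto_pow_atTop_nhds_zero_of_lt_one (r := (1 / 6 : ℝ)) (by norm_num)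
        (by norm_num)).const_mul R
      simpa using this
    · simp only [one_mul]
      exact Metric.mem_closedBall_self (by positivity)
  have hbig := lintegral_ball_two_mul_le hb hM z hR
  rw [← hc, ← hd, ← hL] at hbig
  set A : Set E := {x ∈ Metric.ball z R | s + K < ‖b x - c‖ₑ} with hA
  have hsub2 : ∀ x ∈ Metric.ball z R, Metric.closedBall x R ⊆ Metric.ball z (2 * R) := by
    intro x hx y hy
    rw [Metric.mem_ball] at hx ⊢
    rw [Metric.mem_closedBall] at hy
    linarith [dist_triangle y x z]
  have hradius : ∀ x ∈ A ∩ G, ∃ ρ, 0 < ρ ∧ ρ ≤ R ∧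
      K * μ (Metric.closedBall x ρ) < ∫⁻ y in Metric.closedBall x ρ, ‖b y - c‖ₑ ∂μ ∧
      ∫⁻ y in Metric.ball x (6 * ρ), ‖b y - c‖ₑ ∂μ ≤ K * μ (Metric.ball x (6 * ρ)) := by
    intro x hx
    have := exists_stopping_radius (h := fun y => ‖b y - c‖) (μ := μ) (fun y => norm_nonneg _)
      hlocc (K := K) hR hx.2 (by rw [henorm]; exact lt_of_le_of_lt le_add_self hx.1.2) (by
        simp_rw [henorm]
        rw [addHaar_closedBall_eq_ball x z hR]
        exact (lintegral_mono_set (hsub2 x hx.1.1)).trans (hbig.trans (by gcongr)))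
    simpa only [henorm] using this
  choose! ρ hρ0 hρR hρ1 hρ2 using hradius
  -- The Vitali enlargement by 5 fits strictly inside the open ball enlarged by 6, where the mean of
  -- ‖b - c‖ is at most `K`.
  obtain ⟨u, hut, hdisj, hcov⟩ :=
    Vitali.exists_disjoint_subfamily_covering_enlargement_closedBall (A ∩ G) (fun x => x) ρ R hρR
      5 (by norm_num)
  have hucount : u.Countable := hdisj.countable_of_nonempty_interior fun x hx =>
    ⟨x, Metric.ball_subset_interior_closedBall (Metric.mem_ball_self (hρ0 x (hut hx)))⟩
  -- On the enlarged ball the mean of `b` differs from `c` by at most `K`, so a deviation above `s +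
  -- K` from `c` leaves one above `s` from the local mean.
  have hcover : A ∩ G ⊆ ⋃ y ∈ u,
      {x ∈ Metric.ball y (6 * ρ y) | s < ‖b x - ⨍ w in Metric.ball y (6 * ρ y), b w ∂μ‖ₑ} := by
    intro x hx
    obtain ⟨y, hyu, hy⟩ := hcov x hx
    have hρy := hρ0 y (hut hyu)
    have hxy : x ∈ Metric.ball y (6 * ρ y) :=
      Metric.closedBall_subset_ball (by linarith)
        (hy (Metric.mem_closedBall_self (hρ0 x hx).le))
    refine Set.mem_biUnion hyu ⟨hxy, ?_⟩
    have h6 : 0 < 6 * ρ y := by linarith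
    have hav := (enorm_setAverage_sub_le (integrableOn_ball_of_locallyIntegrable hb y (6 * ρ y))
      (addHaar_ball_ne_zero y h6) (addHaar_ball_ne_top y _) c).trans (hρ2 y (hut hyu))
    have hav' := (ENNReal.mul_le_mul_iff_left (addHaar_ball_ne_zero y h6)
      (addHaar_ball_ne_top y _)).1 hav
    have htri : ‖b x - c‖ₑ ≤ ‖b x - ⨍ w in Metric.ball y (6 * ρ y), b w ∂μ‖ₑ + K := by
      refine le_trans ?_ (add_le_add_right hav' _)
      refine le_trans (le_of_eq ?_) (enorm_add_le _ _)
      congr 1; abel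
    exact (ENNReal.add_lt_add_iff_right hK1).1 (lt_of_lt_of_le hx.1.2 htri)
  have hball6 : ∀ y ∈ u, μ (Metric.ball y (6 * ρ y)) ≤
      6 ^ d * K⁻¹ * ∫⁻ x in Metric.closedBall y (ρ y), ‖b x - c‖ₑ ∂μ := by
    intro y hy
    have hρy := hρ0 y (hut hy)
    have h1 : μ (Metric.ball y (6 * ρ y)) = 6 ^ d * μ (Metric.closedBall y (ρ y)) := by
      rw [addHaar_closedBall_eq_ball y y hρy]
      exact_mod_cast addHaar_ball_natCast_mul (μ := μ) y y (N := 6) (by norm_num) hρy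
    rw [h1, mul_assoc]
    gcongr
    rw [mul_comm, ← div_eq_mul_inv, ENNReal.le_div_iff_mul_le (Or.inl hK0) (Or.inl hK1), mul_comm]
    exact (hρ1 y (hut hy)).le
  have hAG : μ A ≤ μ (A ∩ G) := by
    refine measure_mono_ae ?_
    filter_upwards [hGae] with x hx hxA
    exact ⟨hxA, hx⟩
  have : Countable u := hucount.to_subtype
  calc μ A ≤ μ (A ∩ G) := hAG
    _ ≤ _ := measure_mono hcover
    _ ≤ _ := measure_biUnion_le μ hucount _
    _ ≤ ∑' y : u, t * (6 ^ d * K⁻¹ * ∫⁻ x in Metric.closedBall (y : E) (ρ y), ‖b x - c‖ₑ ∂μ) := by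
        refine ENNReal.tsum_le_tsum fun y => ?_
        exact (h y (6 * ρ y) (by linarith [hρ0 y (hut y.2)])).trans (by gcongr; exact hball6 y y.2)
    _ = t * (6 ^ d * K⁻¹ * ∫⁻ x in ⋃ y ∈ u, Metric.closedBall y (ρ y), ‖b x - c‖ₑ ∂μ) := by
        rw [lintegral_biUnion hucount (fun _ _ => measurableSet_closedBall) hdisj,
          ENNReal.tsum_mul_left, ENNReal.tsum_mul_left]
    _ ≤ t * (6 ^ d * K⁻¹ * (L * μ (Metric.ball z R))) := by
        gcongr
        refine (lintegral_mono_set ?_).trans hbig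
        refine Set.iUnion₂_subset fun y hy => ?_
        exact (Metric.closedBall_subset_closedBall (hρR y (hut hy))).trans
          (hsub2 y (hut hy).1.1)
    _ = t * 2⁻¹ * μ (Metric.ball z R) := by
        -- This identity dictates the choice of `K`: enlargement costs `6 ^ d`, stopping gains
        -- `K⁻¹`, the total oscillation costs `L`.
        have : (6 : ℝ≥0∞) ^ d * K⁻¹ * L = 2⁻¹ := by
          rw [hK, ENNReal.mul_inv (Or.inr hL1) (Or.inr hL0),
            ENNReal.mul_inv (Or.inl (by simp)) (Or.inl (by simp))]
          calc (6 : ℝ≥0∞) ^ d * (2⁻¹ * (6 ^ d)⁻¹ * L⁻¹) * L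
              = 2⁻¹ * (6 ^ d * (6 ^ d)⁻¹) * (L⁻¹ * L) := by ring
            _ = 2⁻¹ := by
              rw [ENNReal.mul_inv_cancel (by simp) (by simp), ENNReal.inv_mul_cancel hL0 hL1,
                mul_one, mul_one]
        rw [← this]; ring

/-- The John–Nirenberg inequality, in the form of bounds on all power means. -/
theorem exists_lintegral_pow_le_of_ballOscillation (hb : LocallyIntegrable b μ)
    (hM : BallOscillationLE μ b M) (hM1 : M ≠ ∞) (r : ℕ) (hr : r ≠ 0) :
    ∃ C : ℝ≥0∞, C ≠ ∞ ∧ ∀ (z : E) (R : ℝ), 0 < R →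
      ∫⁻ x in Metric.ball z R, ‖b x - ⨍ y in Metric.ball z R, b y ∂μ‖ₑ ^ r ∂μ ≤
        C * μ (Metric.ball z R) := by
  -- The level increment must be positive; if `M` vanishes, the bound also holds with 1.
  wlog hM0 : M ≠ 0 generalizing M
  · refine this (M := 1) (fun z r hr => ?_) (by simp) (by simp)
    rw [not_not] at hM0
    have h := hM z r hr
    rw [hM0, zero_mul] at h
    exact h.trans zero_le
  set d := Module.finrank ℝ E
  set K : ℝ≥0∞ := 2 * 6 ^ d * ((1 + 2 ^ d) * 2 ^ d * M) with hK
  have hK0 : K ≠ 0 := by simp [hK, hM0]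
  have hK1 : K ≠ ∞ := ENNReal.mul_ne_top (ENNReal.mul_ne_top (by simp) (by simp))
    (ENNReal.mul_ne_top (ENNReal.mul_ne_top (by simp) (by simp)) hM1)
  -- Exponential decay of the distribution, starting from the trivial bound at level zero.
  have hdist : ∀ m : ℕ, BallDistributionLE μ b (m * K) (2⁻¹ ^ m) := by
    intro m
    induction m with
    | zero =>
      intro z R _
      simp only [pow_zero, one_mul]
      exact measure_mono (Set.sep_subset _ _)
    | succ m ih =>
      have := ih.step hb hM hM0 hM1
      rw [pow_succ]
      push_cast
      rw [add_mul, one_mul]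
      exact this
  refine ⟨∑' m : ℕ, (((m : ℝ≥0∞) + 1) * K) ^ r * 2⁻¹ ^ m, ?_, fun z R hR => ?_⟩
  · have hsum : Summable (fun m : ℕ => ((m : ℝ) + 1) ^ r * (1 / 2 : ℝ) ^ m) := by
      have h1 := summable_pow_mul_geometric_of_norm_lt_one (R := ℝ) r (r := 1 / 2) (by norm_num)
      have h2 := ((summable_nat_add_iff 1).2 h1).mul_left 2
      refine h2.congr fun m => ?_
      push_cast
      rw [pow_succ]; ring
    have h3 : ∀ m : ℕ, (((m : ℝ≥0∞) + 1) * K) ^ r * 2⁻¹ ^ m =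
        K ^ r * ENNReal.ofReal (((m : ℝ) + 1) ^ r * (1 / 2 : ℝ) ^ m) := by
      intro m
      have h5 : (2⁻¹ : ℝ≥0∞) = ENNReal.ofReal (1 / 2) := by
        rw [one_div, ENNReal.ofReal_inv_of_pos two_pos]; simp
      have h4 : (m : ℝ≥0∞) + 1 = ENNReal.ofReal ((m : ℝ) + 1) := by
        rw [ENNReal.ofReal_add (by positivity) (by positivity)]; simp
      rw [ENNReal.ofReal_mul (by positivity), ENNReal.ofReal_pow (by positivity),
        ENNReal.ofReal_pow (by norm_num), mul_pow, h4, h5]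
      ring
    simp_rw [h3]
    rw [ENNReal.tsum_mul_left]
    exact ENNReal.mul_ne_top (ENNReal.pow_ne_top hK1) hsum.tsum_ofReal_ne_top
  · set c := ⨍ y in Metric.ball z R, b y ∂μ with hc
    set B := Metric.ball z R with hB
    obtain ⟨g, hgm, hg⟩ : ∃ g : E → ℝ≥0∞, Measurable g ∧
        (fun x => ‖b x - c‖ₑ) =ᵐ[μ] g := by
      have h1 : AEMeasurable (fun x => ‖b x - c‖ₑ) μ :=
        (hb.aestronglyMeasurable.sub aestronglyMeasurable_const).enorm
      exact ⟨h1.mk _, h1.measurable_mk, h1.ae_eq_mk⟩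
    have hpt : ∀ᵐ x ∂(μ.restrict B), ‖b x - c‖ₑ ^ r ≤
        ∑' m : ℕ, (((m : ℝ≥0∞) + 1) * K) ^ r *
          ({x | (m : ℝ≥0∞) * K < g x}.indicator 1 x) := by
      filter_upwards [ae_restrict_of_ae hg] with x hx
      rw [hx]
      have hfin : g x ≠ ∞ := by rw [← hx]; simp
      by_cases hg0 : g x = 0
      · rw [hg0, zero_pow hr]; exact zero_le
      -- With `m` least, `g x` exceeds `(m - 1) * K`, so the single term of index `m - 1` already
      -- dominates the power.
      have hex : ∃ m : ℕ, g x ≤ m * K := by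
        obtain ⟨m, hm⟩ := ENNReal.exists_nat_gt (ENNReal.div_ne_top hfin hK0)
        refine ⟨m, ?_⟩
        exact (ENNReal.div_le_iff_le_mul (Or.inl hK0) (Or.inl hK1)).1 hm.le
      classical
      set m := Nat.find hex with hm
      have hm1 := Nat.find_spec hex
      rw [← hm] at hm1
      have hm0 : m ≠ 0 := by
        intro h'
        rw [h'] at hm1
        simp only [Nat.cast_zero, zero_mul, nonpos_iff_eq_zero] at hm1
        exact hg0 hm1
      obtain ⟨k, hk⟩ := Nat.exists_eq_succ_of_ne_zero hm0
      have hk1 := not_le.1 (Nat.find_min hex (m := k) (by omega))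
      refine le_trans ?_ (ENNReal.le_tsum k)
      have hmem : x ∈ {x | (k : ℝ≥0∞) * K < g x} := hk1
      rw [Set.indicator_of_mem hmem]
      simp only [Pi.one_apply, mul_one]
      gcongr
      rw [hk] at hm1
      exact_mod_cast hm1
    refine (lintegral_mono_ae hpt).trans ?_
    have hsm : ∀ m : ℕ, MeasurableSet {x | (m : ℝ≥0∞) * K < g x} := fun m =>
      measurableSet_lt measurable_const hgm
    rw [lintegral_tsum fun m => ((measurable_one.indicator (hsm m)).const_mul _).aemeasurable,
      ← ENNReal.tsum_mul_right]
    refine ENNReal.tsum_le_tsum fun m => ?_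
    rw [lintegral_const_mul _ (measurable_one.indicator (hsm m)), mul_assoc]
    gcongr
    rw [lintegral_indicator_one (hsm m), Measure.restrict_apply (hsm m)]
    refine le_trans (measure_mono_ae ?_) (hdist m z R hR)
    filter_upwards [hg] with x hx hxm
    obtain ⟨h1, h2⟩ := hxm
    refine ⟨h2, ?_⟩
    have h1' : (m : ℝ≥0∞) * K < g x := h1
    rw [← hx] at h1'
    exact h1'

end JohnNirenberg

/-! ### Morrey sequence norms -/

/-- The weighted Morrey norm of a sequence indexed by the integers. -/
noncomputable def morreySeqNorm (α lam p : ℝ) (F : ℤ → ℝ≥0∞) : ℝ≥0∞ :=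
  ⨆ k₀ : ℤ, (2 : ℝ≥0∞) ^ (-(k₀ : ℝ) * lam) *
    (∑' k : Set.Iic k₀, (2 : ℝ≥0∞) ^ (((k : ℤ) : ℝ) * α * p) * (F k) ^ p) ^ (1 / p)

theorem two_rpow_ne_zero (x : ℝ) : (2 : ℝ≥0∞) ^ x ≠ 0 :=
  (ENNReal.rpow_pos two_pos (by simp)).ne'

theorem two_rpow_ne_top (x : ℝ) : (2 : ℝ≥0∞) ^ x ≠ ∞ :=
  ENNReal.rpow_ne_top_of_ne_zero two_ne_zero (by simp)

theorem two_rpow_add (x y : ℝ) : (2 : ℝ≥0∞) ^ (x + y) = 2 ^ x * 2 ^ y :=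
  ENNReal.rpow_add _ _ two_ne_zero (by simp)

theorem two_rpow_mono {x y : ℝ} (h : x ≤ y) : (2 : ℝ≥0∞) ^ x ≤ 2 ^ y :=
  ENNReal.rpow_le_rpow_of_exponent_le (by norm_num) h

theorem ofReal_two_rpow (x : ℝ) : ENNReal.ofReal ((2 : ℝ) ^ x) = 2 ^ x := by
  rw [← ENNReal.ofReal_rpow_of_pos two_pos]; simp

theorem ofReal_two_zpow (k : ℤ) : ENNReal.ofReal ((2 : ℝ) ^ k) = 2 ^ (k : ℝ) := by
  rw [← ofReal_two_rpow, Real.rpow_intCast]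

theorem tsum_two_rpow_neg_abs_ne_top {ε : ℝ} (hε : 0 < ε) :
    ∑' m : ℤ, (2 : ℝ≥0∞) ^ (-(ε * |(m : ℝ)|)) ≠ ∞ := by
  have h1 : ∀ m : ℤ, (2 : ℝ≥0∞) ^ (-(ε * |(m : ℝ)|)) =
      ENNReal.ofReal ((2 : ℝ) ^ (-(ε * |(m : ℝ)|))) := fun m => (ofReal_two_rpow _).symm
  simp_rw [h1]
  have h2 : Summable fun m : ℕ => (2 : ℝ) ^ (-(ε * (m : ℝ))) := by
    have h3 := summable_geometric_of_lt_one (r := (2 : ℝ) ^ (-ε)) (by positivity)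
      (Real.rpow_lt_one_of_one_lt_of_neg one_lt_two (by linarith))
    refine h3.congr fun m => ?_
    rw [← Real.rpow_natCast, ← Real.rpow_mul two_pos.le]
    ring_nf
  refine (Summable.of_nat_of_neg ?_ ?_).tsum_ofReal_ne_top
  · refine h2.congr fun m => ?_
    simp
  · refine h2.congr fun m => ?_
    simp

/-- A power of a sum is controlled by the sum of powers with geometric weights. -/
theorem tsum_rpow_le_weighted {p : ℝ} (hp : 0 < p) (ε : ℝ) (a : ℤ → ℝ≥0∞) :
    (∑' m, a m) ^ p ≤ (∑' m : ℤ, (2 : ℝ≥0∞) ^ (-(ε * |(m : ℝ)|))) ^ p *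
      ∑' m : ℤ, (2 ^ (ε * |(m : ℝ)|) * a m) ^ p := by
  set S := ∑' m : ℤ, ((2 : ℝ≥0∞) ^ (ε * |(m : ℝ)|) * a m) ^ p with hS
  -- Each weighted term is at most the whole ℓ^p norm. This replaces the triangle inequality and
  -- needs no lower bound on `p` beyond positivity.
  have h1 : ∀ m, a m ≤ 2 ^ (-(ε * |(m : ℝ)|)) * S ^ (1 / p) := by
    intro m
    have h2 : (2 : ℝ≥0∞) ^ (ε * |(m : ℝ)|) * a m ≤ S ^ (1 / p) := by
      have h3 := ENNReal.le_tsum (f := fun m : ℤ => ((2 : ℝ≥0∞) ^ (ε * |(m : ℝ)|) * a m) ^ p) m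
      have h4 := ENNReal.rpow_le_rpow h3 (one_div_pos.2 hp).le
      rwa [← ENNReal.rpow_mul, mul_one_div_cancel hp.ne', ENNReal.rpow_one] at h4
    calc a m = 2 ^ (-(ε * |(m : ℝ)|)) * (2 ^ (ε * |(m : ℝ)|) * a m) := by
          rw [← mul_assoc, ← two_rpow_add]; simp
      _ ≤ _ := by gcongr
  calc (∑' m, a m) ^ p ≤ (∑' m : ℤ, 2 ^ (-(ε * |(m : ℝ)|)) * S ^ (1 / p)) ^ p :=
        ENNReal.rpow_le_rpow (ENNReal.tsum_le_tsum h1) hp.le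
    _ = _ := by
        rw [ENNReal.tsum_mul_right, ENNReal.mul_rpow_of_nonneg _ _ hp.le,
          ← ENNReal.rpow_mul S, one_div_mul_cancel hp.ne', ENNReal.rpow_one]

theorem tsum_Iic_le_morreySeqNorm {α lam p : ℝ} (hp : 0 < p) (F : ℤ → ℝ≥0∞) (k₀ : ℤ) :
    ∑' k : Set.Iic k₀, (2 : ℝ≥0∞) ^ (((k : ℤ) : ℝ) * α * p) * (F k) ^ p ≤
      (2 ^ ((k₀ : ℝ) * lam) * morreySeqNorm α lam p F) ^ p := by
  set S := ∑' k : Set.Iic k₀, (2 : ℝ≥0∞) ^ (((k : ℤ) : ℝ) * α * p) * (F k) ^ p with hS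
  have h1 : (2 : ℝ≥0∞) ^ (-(k₀ : ℝ) * lam) * S ^ (1 / p) ≤ morreySeqNorm α lam p F :=
    le_iSup (fun k₀ : ℤ => (2 : ℝ≥0∞) ^ (-(k₀ : ℝ) * lam) *
      (∑' k : Set.Iic k₀, (2 : ℝ≥0∞) ^ (((k : ℤ) : ℝ) * α * p) * (F k) ^ p) ^ (1 / p)) k₀
  have h2 : S ^ (1 / p) ≤ 2 ^ ((k₀ : ℝ) * lam) * morreySeqNorm α lam p F := by
    calc S ^ (1 / p) = 2 ^ ((k₀ : ℝ) * lam) * (2 ^ (-(k₀ : ℝ) * lam) * S ^ (1 / p)) := by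
          rw [← mul_assoc, ← two_rpow_add]; simp
      _ ≤ _ := by gcongr
  have h3 := ENNReal.rpow_le_rpow h2 hp.le
  rwa [← ENNReal.rpow_mul, one_div_mul_cancel hp.ne', ENNReal.rpow_one] at h3

theorem morreySeqNorm_apply_ne_top {α lam p : ℝ} (hp : 0 < p) {F : ℤ → ℝ≥0∞}
    (hF : morreySeqNorm α lam p F ≠ ∞) (k : ℤ) : F k ≠ ∞ := by
  intro h
  have h1 := (ENNReal.le_tsum (f := fun k : Set.Iic k =>
    (2 : ℝ≥0∞) ^ (((k : ℤ) : ℝ) * α * p) * (F k) ^ p) ⟨k, le_refl k⟩).trans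
    (tsum_Iic_le_morreySeqNorm (α := α) (lam := lam) hp F k)
  simp only [h, ENNReal.top_rpow_of_pos hp, ENNReal.mul_top (two_rpow_ne_zero _)] at h1
  exact ENNReal.rpow_ne_top_of_nonneg hp.le (ENNReal.mul_ne_top (two_rpow_ne_top _) hF)
    (top_le_iff.1 h1)

/-- Convolution with an exponentially decaying kernel is bounded for Morrey sequence norms. -/
theorem exists_morreySeqNorm_convolution_le {α lam p ε : ℝ} (hp : 0 < p) (hε : 0 < ε)
    {w : ℤ → ℝ≥0∞} {C₀ : ℝ≥0∞} (hC₀ : C₀ ≠ ∞)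
    (hw : ∀ m : ℤ, w m ≤ C₀ * 2 ^ ((m : ℝ) * (lam - α) - 2 * (ε * |(m : ℝ)|))) :
    ∃ C : ℝ≥0∞, C ≠ ∞ ∧ ∀ F : ℤ → ℝ≥0∞,
      morreySeqNorm α lam p (fun k => ∑' j, w (k - j) * F j) ≤ C * morreySeqNorm α lam p F := by
  set K := ∑' m : ℤ, (2 : ℝ≥0∞) ^ (-(ε * |(m : ℝ)|)) with hK
  set K' := ∑' m : ℤ, (2 : ℝ≥0∞) ^ (-(ε * p * |(m : ℝ)|)) with hK'
  have hK1 : K ≠ ∞ := tsum_two_rpow_neg_abs_ne_top hε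
  have hK2 : K' ≠ ∞ := tsum_two_rpow_neg_abs_ne_top (mul_pos hε hp)
  refine ⟨K * C₀ * K' ^ (1 / p), ENNReal.mul_ne_top (ENNReal.mul_ne_top hK1 hC₀)
    (ENNReal.rpow_ne_top_of_nonneg (one_div_pos.2 hp).le hK2), fun F => ?_⟩
  set N := morreySeqNorm α lam p F with hN
  set g : ℤ → ℝ≥0∞ := fun j => 2 ^ ((j : ℝ) * α * p) * F j ^ p with hg
  -- One of the two factors 2^(-ε|m|) in `hw` pays for moving the power inside the sum; the other is
  -- left for summing over the shifts.
  have hpt : ∀ k : ℤ, (2 : ℝ≥0∞) ^ ((k : ℝ) * α * p) * (∑' j, w (k - j) * F j) ^ p ≤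
      K ^ p * ∑' m : ℤ, (C₀ * 2 ^ ((m : ℝ) * lam - ε * |(m : ℝ)|)) ^ p * g (k - m) := by
    intro k
    have e1 : ∑' j, w (k - j) * F j = ∑' m, w m * F (k - m) := by
      rw [← (Equiv.subLeft k).tsum_eq (fun j => w (k - j) * F j)]
      simp
    have e2 : (2 : ℝ≥0∞) ^ ((k : ℝ) * α * p) * (∑' m, w m * F (k - m)) ^ p =
        (∑' m, 2 ^ ((k : ℝ) * α) * (w m * F (k - m))) ^ p := by
      rw [ENNReal.tsum_mul_left, ENNReal.mul_rpow_of_nonneg _ _ hp.le, ← ENNReal.rpow_mul]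
    rw [e1, e2]
    refine (tsum_rpow_le_weighted hp ε _).trans ?_
    gcongr with m
    have e3 : g (k - m) = (2 ^ (((k : ℝ) - m) * α) * F (k - m)) ^ p := by
      simp only [hg]
      rw [ENNReal.mul_rpow_of_nonneg _ _ hp.le, ← ENNReal.rpow_mul]
      push_cast; rfl
    rw [e3, ← ENNReal.mul_rpow_of_nonneg _ _ hp.le]
    refine ENNReal.rpow_le_rpow ?_ hp.le
    calc (2 : ℝ≥0∞) ^ (ε * |(m : ℝ)|) * (2 ^ ((k : ℝ) * α) * (w m * F (k - m)))
        ≤ 2 ^ (ε * |(m : ℝ)|) * (2 ^ ((k : ℝ) * α) *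
            ((C₀ * 2 ^ ((m : ℝ) * (lam - α) - 2 * (ε * |(m : ℝ)|))) * F (k - m))) := by
          gcongr; exact hw m
      _ = C₀ * (2 ^ (ε * |(m : ℝ)|) * 2 ^ ((k : ℝ) * α) *
            2 ^ ((m : ℝ) * (lam - α) - 2 * (ε * |(m : ℝ)|))) * F (k - m) := by ring
      _ = C₀ * (2 ^ ((m : ℝ) * lam - ε * |(m : ℝ)|) * 2 ^ (((k : ℝ) - m) * α)) *
            F (k - m) := by
          congr 2
          rw [← two_rpow_add, ← two_rpow_add, ← two_rpow_add]
          congr 1; ring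
      _ = _ := by ring
  refine iSup_le fun k₀ => ?_
  have hsum : ∑' k : Set.Iic k₀, (2 : ℝ≥0∞) ^ (((k : ℤ) : ℝ) * α * p) *
      (∑' j, w (k - j) * F j) ^ p ≤ (K * C₀ * (2 ^ ((k₀ : ℝ) * lam) * N)) ^ p * K' := by
    -- A shift moves the cutoff to `k₀ - m`; the resulting 2^(-m lam) cancels the 2^(m lam) carried
    -- by the weight.
    have hshift : ∀ m : ℤ, ∑' k : Set.Iic k₀, g (k - m) ≤
        (2 ^ (((k₀ : ℝ) - m) * lam) * N) ^ p := by
      intro m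
      have h1 := tsum_Iic_le_morreySeqNorm (α := α) (lam := lam) hp F (k₀ - m)
      push_cast at h1
      refine le_trans (le_of_eq ?_) h1
      rw [tsum_subtype (Set.Iic k₀) (fun k => g (k - m)), tsum_subtype (Set.Iic (k₀ - m)) g,
        ← (Equiv.subRight m).tsum_eq ((Set.Iic (k₀ - m)).indicator g)]
      refine tsum_congr fun k => ?_
      simp only [Set.indicator, Set.mem_Iic, Equiv.subRight_apply, sub_le_sub_iff_right]
    calc _ ≤ ∑' k : Set.Iic k₀, K ^ p *
          ∑' m : ℤ, (C₀ * 2 ^ ((m : ℝ) * lam - ε * |(m : ℝ)|)) ^ p * g (k - m) :=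
          ENNReal.tsum_le_tsum fun k => hpt k
      _ = K ^ p * ∑' m : ℤ, (C₀ * 2 ^ ((m : ℝ) * lam - ε * |(m : ℝ)|)) ^ p *
          ∑' k : Set.Iic k₀, g (k - m) := by
          rw [ENNReal.tsum_mul_left, ENNReal.tsum_comm]
          simp_rw [ENNReal.tsum_mul_left]
      _ ≤ K ^ p * ∑' m : ℤ, (C₀ * 2 ^ ((m : ℝ) * lam - ε * |(m : ℝ)|)) ^ p *
          (2 ^ (((k₀ : ℝ) - m) * lam) * N) ^ p := by
          gcongr with m
          exact hshift m
      _ = K ^ p * ∑' m : ℤ, (C₀ * (2 ^ ((k₀ : ℝ) * lam) * N)) ^ p *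
          2 ^ (-(ε * p * |(m : ℝ)|)) := by
          congr 2
          funext m
          have e4 : (2 : ℝ≥0∞) ^ (-(ε * p * |(m : ℝ)|)) = (2 ^ (-(ε * |(m : ℝ)|))) ^ p := by
            rw [← ENNReal.rpow_mul]; congr 1; ring
          rw [e4, ← ENNReal.mul_rpow_of_nonneg _ _ hp.le, ← ENNReal.mul_rpow_of_nonneg _ _ hp.le]
          congr 1
          calc C₀ * 2 ^ ((m : ℝ) * lam - ε * |(m : ℝ)|) * (2 ^ (((k₀ : ℝ) - m) * lam) * N)
              = C₀ * (2 ^ ((m : ℝ) * lam - ε * |(m : ℝ)|) * 2 ^ (((k₀ : ℝ) - m) * lam)) * N := by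
                ring
            _ = C₀ * (2 ^ ((k₀ : ℝ) * lam) * 2 ^ (-(ε * |(m : ℝ)|))) * N := by
                rw [← two_rpow_add, ← two_rpow_add]
                congr 3; ring
            _ = _ := by ring
      _ = _ := by
          rw [ENNReal.tsum_mul_left, ← mul_assoc, ← ENNReal.mul_rpow_of_nonneg _ _ hp.le, mul_assoc]
  calc _ ≤ (2 : ℝ≥0∞) ^ (-(k₀ : ℝ) * lam) *
        ((K * C₀ * (2 ^ ((k₀ : ℝ) * lam) * N)) ^ p * K') ^ (1 / p) := by
        gcongr
    _ = (2 ^ (-(k₀ : ℝ) * lam) * 2 ^ ((k₀ : ℝ) * lam)) * (K * C₀ * K' ^ (1 / p) * N) := by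
        rw [ENNReal.mul_rpow_of_nonneg _ _ (one_div_pos.2 hp).le, ← ENNReal.rpow_mul,
          mul_one_div_cancel hp.ne', ENNReal.rpow_one]
        ring
    _ = _ := by
        rw [← two_rpow_add]; simp

/-- The weight that relates the annuli of indices `j` and `j + m`. -/
noncomputable def annulusWeight (Q : ℝ) (n : ℕ) (m : ℤ) : ℝ≥0∞ :=
  ((1 + m.natAbs : ℕ) : ℝ≥0∞) * 2 ^ ((m : ℝ) * Q - max (m : ℝ) 0 * n)

theorem exists_one_add_le_two_rpow {ε : ℝ} (hε : 0 < ε) :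
    ∃ C : ℝ≥0∞, C ≠ ∞ ∧ ∀ m : ℤ, ((1 + m.natAbs : ℕ) : ℝ≥0∞) ≤ C * 2 ^ (ε * |(m : ℝ)|) := by
  have hl : 0 < Real.log 2 := Real.log_pos one_lt_two
  refine ⟨ENNReal.ofReal (1 + 1 / (ε * Real.log 2)), ENNReal.ofReal_ne_top, fun m => ?_⟩
  have hm : (0 : ℝ) ≤ |(m : ℝ)| := abs_nonneg _
  rw [← ofReal_two_rpow, ← ENNReal.ofReal_mul (by positivity), ← ENNReal.ofReal_natCast]
  refine ENNReal.ofReal_le_ofReal ?_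
  push_cast
  rw [Nat.cast_natAbs, Int.cast_abs]
  have h1 : 1 + ε * |(m : ℝ)| * Real.log 2 ≤ 2 ^ (ε * |(m : ℝ)|) := by
    rw [Real.rpow_def_of_pos two_pos]
    linarith [Real.add_one_le_exp (Real.log 2 * (ε * |(m : ℝ)|))]
  have h2 : (1 + 1 / (ε * Real.log 2)) * (1 + ε * |(m : ℝ)| * Real.log 2) =
      1 + |(m : ℝ)| + (ε * |(m : ℝ)| * Real.log 2 + 1 / (ε * Real.log 2)) := by
    field_simp
    ring
  calc 1 + |(m : ℝ)| ≤ (1 + 1 / (ε * Real.log 2)) * (1 + ε * |(m : ℝ)| * Real.log 2) := by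
        rw [h2]
        have : 0 ≤ ε * |(m : ℝ)| * Real.log 2 + 1 / (ε * Real.log 2) := by positivity
        linarith
    _ ≤ _ := by gcongr

theorem exists_morreySeqNorm_annulusWeight_le {α lam p Q : ℝ} {n : ℕ} (hlam : 0 ≤ lam) (hp : 0 < p)
    (h1 : lam - Q < α) (h2 : α < n - Q) :
    ∃ C : ℝ≥0∞, C ≠ ∞ ∧ ∀ F : ℤ → ℝ≥0∞,
      morreySeqNorm α lam p (fun k => ∑' j, annulusWeight Q n (k - j) * F j) ≤
        C * morreySeqNorm α lam p F := by
  -- One third of the gap absorbs the factor `1 + |m|`, the other two are the decay demanded by the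
  -- convolution bound.
  set ε := min (α - (lam - Q)) (n - Q - α) / 3 with hε
  have hε0 : 0 < ε := by
    have : 0 < min (α - (lam - Q)) (n - Q - α) := lt_min (by linarith) (by linarith)
    positivity
  have hε1 : 3 * ε ≤ α - (lam - Q) := by
    rw [hε]; linarith [min_le_left (α - (lam - Q)) (n - Q - α)]
  have hε2 : 3 * ε ≤ n - Q - α := by
    rw [hε]; linarith [min_le_right (α - (lam - Q)) (n - Q - α)]
  obtain ⟨C, hC, hCm⟩ := exists_one_add_le_two_rpow hε0
  refine exists_morreySeqNorm_convolution_le hp hε0 hC fun m => ?_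
  calc annulusWeight Q n m
      ≤ (C * 2 ^ (ε * |(m : ℝ)|)) * 2 ^ ((m : ℝ) * Q - max (m : ℝ) 0 * n) := by
        unfold annulusWeight
        gcongr
        exact hCm m
    _ = C * 2 ^ (ε * |(m : ℝ)| + ((m : ℝ) * Q - max (m : ℝ) 0 * n)) := by
        rw [mul_assoc, ← two_rpow_add]
    _ ≤ _ := by
        gcongr
        · norm_num
        rcases le_total 0 (m : ℝ) with hm | hm
        · rw [abs_of_nonneg hm, max_eq_left hm]
          nlinarith [mul_nonneg hm hlam, mul_le_mul_of_nonneg_left hε2 hm]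
        · rw [abs_of_nonpos hm, max_eq_right hm]
          nlinarith [mul_le_mul_of_nonneg_left hε1 (neg_nonneg.2 hm)]

/-! ### Functions of bounded mean oscillation on dyadic balls and annuli -/

section BMO

variable {𝕜 : Type*} [RCLike 𝕜] {n : ℕ}

theorem dyadicBall_eq_closedBall (n : ℕ) (k : ℤ) :
    dyadicBall n k = Metric.closedBall 0 ((2 : ℝ) ^ k) := by
  ext x
  simp [dyadicBall]

theorem isClosed_dyadicBall (n : ℕ) (k : ℤ) : IsClosed (dyadicBall n k) := by
  rw [dyadicBall_eq_closedBall]; exact Metric.isClosed_closedBall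

theorem measurableSet_dyadicBall (n : ℕ) (k : ℤ) : MeasurableSet (dyadicBall n k) :=
  (isClosed_dyadicBall n k).measurableSet

theorem measurableSet_annulus (n : ℕ) (k : ℤ) : MeasurableSet (annulus n k) :=
  (measurableSet_dyadicBall n k).diff (measurableSet_dyadicBall n (k - 1))

theorem annulus_subset_dyadicBall (n : ℕ) (k : ℤ) : annulus n k ⊆ dyadicBall n k :=
  Set.sdiff_subset

theorem mem_annulus_iff {k : ℤ} {x : EuclideanSpace ℝ (Fin n)} :
    x ∈ annulus n k ↔ ‖x‖ ≤ (2 : ℝ) ^ k ∧ (2 : ℝ) ^ (k - 1) < ‖x‖ := by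
  simp [annulus, dyadicBall]

theorem exists_mem_annulus {x : EuclideanSpace ℝ (Fin n)} (hx : x ≠ 0) :
    ∃ k : ℤ, x ∈ annulus n k := by
  obtain ⟨k, hk⟩ := exists_mem_Ioc_zpow (norm_pos_iff.2 hx) one_lt_two
  refine ⟨k + 1, mem_annulus_iff.2 ⟨hk.2, ?_⟩⟩
  rw [add_sub_cancel_right]
  exact hk.1

theorem MemBMO.exists_ballOscillationLE {b : EuclideanSpace ℝ (Fin n) → 𝕜} (hb : MemBMO b) :
    ∃ M : ℝ≥0∞, M ≠ ∞ ∧ BallOscillationLE volume b M := by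
  obtain ⟨hloc, M, hM⟩ := hb
  refine ⟨ENNReal.ofReal M, ENNReal.ofReal_ne_top, fun z r hr => ?_⟩
  have h0 := addHaar_ball_ne_zero (μ := volume) z hr
  have h1 := addHaar_ball_ne_top (μ := volume) z r
  have h := hM z r hr
  set c := ⨍ y in Metric.ball z r, b y
  have hint : Integrable (fun x => b x - c) (volume.restrict (Metric.ball z r)) :=
    (integrableOn_ball_of_locallyIntegrable hloc z r).sub (integrableOn_const h1)
  rw [← ofReal_integral_norm_eq_lintegral_enorm hint, ← ofReal_measureReal h1,
    ← ENNReal.ofReal_mul' measureReal_nonneg]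
  refine ENNReal.ofReal_le_ofReal ?_
  have hpos : 0 < volume.real (Metric.ball z r) := ENNReal.toReal_pos h0 h1
  rwa [setAverage_eq, smul_eq_mul, inv_mul_le_iff₀ hpos, mul_comm] at h

/-- The mean over the ball of radius `2 ^ k` centred at the origin. -/
noncomputable def ballMean (b : EuclideanSpace ℝ (Fin n) → 𝕜) (k : ℤ) : 𝕜 :=
  ⨍ y in Metric.ball 0 ((2 : ℝ) ^ k), b y

/-- Consecutive dyadic means differ by a bounded amount; telescoping gives linear growth in the
number of steps. -/
theorem MemBMO.exists_ballMean_sub_le {b : EuclideanSpace ℝ (Fin n) → 𝕜} (hb : MemBMO b) :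
    ∃ C : ℝ≥0∞, C ≠ ∞ ∧ ∀ k j : ℤ, ‖ballMean b k - ballMean b j‖ₑ ≤ C * (k - j).natAbs := by
  obtain ⟨M, hM1, hM⟩ := hb.exists_ballOscillationLE
  refine ⟨2 ^ n * M, ENNReal.mul_ne_top (by simp) hM1, ?_⟩
  have hstep : ∀ k : ℤ, ‖ballMean b (k + 1) - ballMean b k‖ₑ ≤ 2 ^ n * M := by
    intro k
    have h := enorm_setAverage_ball_sub_le hb.1 hM (z := 0) (w := 0) (N := 2) two_pos
      (r := (2 : ℝ) ^ k) (by positivity)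
      (Metric.ball_subset_ball (by push_cast; linarith [zpow_pos (two_pos (α := ℝ)) k]))
    have h2 : ((2 : ℕ) : ℝ) * 2 ^ k = 2 ^ (k + 1) := by
      rw [zpow_add_one₀ two_ne_zero]; push_cast; ring
    rw [h2, finrank_euclideanSpace_fin] at h
    rw [← enorm_neg, neg_sub]
    exact_mod_cast h
  have hnat : ∀ (k : ℤ) (m : ℕ), ‖ballMean b (k + m) - ballMean b k‖ₑ ≤ 2 ^ n * M * m := by
    intro k m
    induction m with
    | zero => simp
    | succ m ih =>
      have : ballMean b (k + (m + 1 : ℕ)) - ballMean b k =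
          (ballMean b (k + m) - ballMean b k) + (ballMean b (k + m + 1) - ballMean b (k + m)) := by
        push_cast
        rw [← add_assoc]; abel
      rw [this]
      refine (enorm_add_le _ _).trans ?_
      push_cast
      rw [mul_add, mul_one]
      exact add_le_add ih (hstep _)
  intro k j
  rcases le_total j k with h | h
  · have := hnat j (k - j).natAbs
    rwa [Int.natAbs_of_nonneg (by omega), add_sub_cancel] at this
  · have := hnat k (j - k).natAbs
    rw [Int.natAbs_of_nonneg (by omega), add_sub_cancel] at this
    rw [← enorm_neg, neg_sub, ← Int.natAbs_neg, neg_sub]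
    exact this

/-- John–Nirenberg bounds the oscillation in an ordinary Lebesgue space of large exponent, which on
a ball embeds into the mixed space. The added 1 lets one estimate cover both the oscillation and the
constants. -/
theorem MemBMO.exists_mixedENorm_le {b : EuclideanSpace ℝ (Fin n) → 𝕜} (hb : MemBMO b)
    {q : Fin n → ℝ} (hq : ∀ i, 1 < q i) :
    ∃ C : ℝ≥0∞, C ≠ ∞ ∧ ∀ k : ℤ,
      mixedENorm q ((dyadicBall n k).indicator fun x => ‖b x - ballMean b k‖ₑ + 1) ≤
        C * 2 ^ ((k : ℝ) * ∑ i, 1 / q i) := by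
  -- The sum of the positive exponents exceeds each of them, and a natural `r` suits the power form
  -- of John–Nirenberg.
  obtain ⟨r, hr⟩ := exists_nat_gt (∑ i, q i)
  have hqr : ∀ i, q i < r := fun i => lt_of_le_of_lt
    (Finset.single_le_sum (f := q) (fun j _ => by linarith [hq j]) (Finset.mem_univ i)) hr
  have hr0 : (0 : ℝ) < r := lt_of_le_of_lt
    (Finset.sum_nonneg fun j _ => by linarith [hq j]) hr
  have hrn : r ≠ 0 := by rintro rfl; simp at hr0
  obtain ⟨M, hM1, hM⟩ := hb.exists_ballOscillationLE
  obtain ⟨C, hC, hJN⟩ := exists_lintegral_pow_le_of_ballOscillation hb.1 hM hM1 r hrn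
  set v := volume (Metric.ball (0 : EuclideanSpace ℝ (Fin n)) 1) with hv
  have hv1 : v ≠ ∞ := addHaar_ball_ne_top _ _
  set Q := ∑ i, 1 / q i with hQ
  set D : ℝ≥0∞ := 2 ^ r * (C + 1) * v with hD
  have hD1 : D ≠ ∞ := ENNReal.mul_ne_top (ENNReal.mul_ne_top (by simp) (by simp [hC])) hv1
  refine ⟨2 ^ (Q - n / r) * D ^ (1 / (r : ℝ)), ENNReal.mul_ne_top (two_rpow_ne_top _)
    (ENNReal.rpow_ne_top_of_nonneg (by positivity) hD1), fun k => ?_⟩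
  have hk : (0 : ℝ) < 2 ^ k := by positivity
  have hvol : volume (Metric.ball (0 : EuclideanSpace ℝ (Fin n)) ((2 : ℝ) ^ k)) =
      2 ^ ((k : ℝ) * n) * v := by
    rw [Measure.addHaar_ball_of_pos _ _ hk, finrank_euclideanSpace_fin,
      ENNReal.ofReal_pow hk.le, ofReal_two_zpow, ← ENNReal.rpow_natCast, ← ENNReal.rpow_mul]
  have haem : AEMeasurable (fun x => ‖b x - ballMean b k‖ₑ) :=
    (hb.1.aestronglyMeasurable.sub aestronglyMeasurable_const).enorm
  have hpow : ∫⁻ x in Metric.closedBall (0 : EuclideanSpace ℝ (Fin n)) ((2 : ℝ) ^ k),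
      (‖b x - ballMean b k‖ₑ + 1) ^ (r : ℝ) ≤ D * 2 ^ ((k : ℝ) * n) := by
    have hae : Metric.ball (0 : EuclideanSpace ℝ (Fin n)) ((2 : ℝ) ^ k) =ᵐ[volume]
        Metric.closedBall 0 ((2 : ℝ) ^ k) :=
      ae_eq_of_subset_of_measure_ge Metric.ball_subset_closedBall
        (addHaar_closedBall_eq_ball 0 0 hk).le measurableSet_ball.nullMeasurableSet
        measure_closedBall_lt_top.ne
    rw [setLIntegral_congr hae.symm]
    calc _ ≤ ∫⁻ x in Metric.ball (0 : EuclideanSpace ℝ (Fin n)) ((2 : ℝ) ^ k),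
          2 ^ r * (‖b x - ballMean b k‖ₑ ^ r + 1) := by
          refine lintegral_mono fun x => ?_
          rw [ENNReal.rpow_natCast]
          set X := ‖b x - ballMean b k‖ₑ
          have h1 : X + 1 ≤ 2 * max X 1 := by
            rw [two_mul]; exact add_le_add (le_max_left _ _) (le_max_right _ _)
          refine (pow_le_pow_left' h1 r).trans ?_
          rw [mul_pow]
          gcongr
          rcases le_total X 1 with h | h
          · rw [max_eq_right h, one_pow]; exact le_add_self
          · rw [max_eq_left h]; exact le_self_add
      _ = 2 ^ r * ((∫⁻ x in Metric.ball (0 : EuclideanSpace ℝ (Fin n)) ((2 : ℝ) ^ k),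
          ‖b x - ballMean b k‖ₑ ^ r) +
            1 * volume (Metric.ball (0 : EuclideanSpace ℝ (Fin n)) ((2 : ℝ) ^ k))) := by
          rw [lintegral_const_mul' _ _ (by simp), lintegral_add_right _ measurable_const,
            setLIntegral_const]
      _ ≤ 2 ^ r * (C * volume (Metric.ball (0 : EuclideanSpace ℝ (Fin n)) ((2 : ℝ) ^ k)) +
            1 * volume (Metric.ball (0 : EuclideanSpace ℝ (Fin n)) ((2 : ℝ) ^ k))) := by
          gcongr
          exact hJN 0 _ hk
      _ = _ := by rw [hvol]; ring
  rw [dyadicBall_eq_closedBall]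
  refine (mixedENorm_indicator_closedBall_le hq hr0 hqr hk (haem.add_const 1)).trans ?_
  have h2 : ENNReal.ofReal (2 * 2 ^ k) = 2 ^ ((k : ℝ) + 1) := by
    rw [ENNReal.ofReal_mul two_pos.le, ofReal_two_zpow, two_rpow_add, ENNReal.rpow_one, mul_comm]
    simp
  have h3 : ∑ i, (1 / q i - 1 / (r : ℝ)) = Q - n / r := by
    rw [Finset.sum_sub_distrib]; simp [hQ, div_eq_mul_inv]
  rw [h2, h3]
  calc _ ≤ (2 ^ ((k : ℝ) + 1)) ^ (Q - n / r) * (D * 2 ^ ((k : ℝ) * n)) ^ (1 / (r : ℝ)) := by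
        gcongr
    _ = (2 ^ (((k : ℝ) + 1) * (Q - n / r)) * 2 ^ ((k : ℝ) * n * (1 / (r : ℝ)))) *
        D ^ (1 / (r : ℝ)) := by
        rw [ENNReal.mul_rpow_of_nonneg _ _ (by positivity), ← ENNReal.rpow_mul,
          ← ENNReal.rpow_mul]
        ring
    _ = (2 ^ (Q - n / r) * 2 ^ ((k : ℝ) * Q)) * D ^ (1 / (r : ℝ)) := by
        rw [← two_rpow_add, ← two_rpow_add]
        congr 2; ring
    _ = _ := by ring

/-- The exponents conjugate to `q`. -/
theorem exists_conjugate_exponents {q : Fin n → ℝ} (hq : ∀ i, 1 < q i) :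
    ∃ q' : Fin n → ℝ, (∀ i, (q i).HolderConjugate (q' i)) ∧
      ∑ i, 1 / q' i = n - ∑ i, 1 / q i := by
  refine ⟨fun i => Real.conjExponent (q i), fun i => Real.HolderConjugate.conjExponent (hq i), ?_⟩
  rw [eq_sub_iff_add_eq, ← Finset.sum_add_distrib]
  have : ∀ i, 1 / Real.conjExponent (q i) + 1 / q i = 1 := fun i => by
    have := (Real.HolderConjugate.conjExponent (hq i)).inv_add_inv_eq_one
    rw [one_div, one_div, add_comm]; exact this
  rw [Finset.sum_congr rfl fun i _ => this i]
  simp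

theorem enorm_indicator_eq {s : Set (EuclideanSpace ℝ (Fin n))}
    (f : EuclideanSpace ℝ (Fin n) → 𝕜) :
    (fun x => ‖s.indicator f x‖ₑ) = s.indicator fun x => ‖f x‖ₑ := by
  funext x
  exact enorm_indicator_eq_indicator_enorm f x

theorem mixedNorm_indicator_eq {q : Fin n → ℝ} (s : Set (EuclideanSpace ℝ (Fin n)))
    (f : EuclideanSpace ℝ (Fin n) → 𝕜) :
    mixedNorm q (s.indicator f) = mixedENorm q (s.indicator fun x => ‖f x‖ₑ) := by
  rw [← enorm_indicator_eq]; rfl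

/-- Hölder's inequality on a subset of a dyadic ball, with a function of bounded mean oscillation
as weight. -/
theorem MemBMO.exists_setLIntegral_le {b : EuclideanSpace ℝ (Fin n) → 𝕜} (hb : MemBMO b)
    {q : Fin n → ℝ} (hq : ∀ i, 1 < q i) :
    ∃ C : ℝ≥0∞, C ≠ ∞ ∧ ∀ f : EuclideanSpace ℝ (Fin n) → 𝕜, AEStronglyMeasurable f volume →
      ∀ (j : ℤ) (s : Set (EuclideanSpace ℝ (Fin n))), MeasurableSet s → s ⊆ dyadicBall n j →
        ∫⁻ y in s, (‖b y - ballMean b j‖ₑ + 1) * ‖f y‖ₑ ≤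
          C * 2 ^ ((j : ℝ) * (n - ∑ i, 1 / q i)) * mixedNorm q (s.indicator f) := by
  obtain ⟨q', hqq, hsum⟩ := exists_conjugate_exponents hq
  obtain ⟨C, hC, hCk⟩ := hb.exists_mixedENorm_le (fun i => (hqq i).symm.lt)
  refine ⟨C, hC, fun f hf j s hs hsub => ?_⟩
  have haem : AEMeasurable (fun x => ‖b x - ballMean b j‖ₑ + 1) :=
    (hb.1.aestronglyMeasurable.sub aestronglyMeasurable_const).enorm.add_const 1
  rw [← hsum]
  refine le_trans ?_ (mul_le_mul_left (hCk j) _)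
  rw [mixedNorm_indicator_eq, mul_comm, ← lintegral_indicator hs]
  refine le_trans (lintegral_mono fun y => ?_) (lintegral_mul_le_mixedENorm hqq
    (hf.enorm.indicator hs) (haem.indicator (measurableSet_dyadicBall n j)))
  by_cases hy : y ∈ s
  · simp only [hy, hsub hy, Set.indicator_of_mem, mul_comm, le_refl]
  · simp [hy]

/-- Pass from `b x` to `b y` through the means over B_k and B_j: the first deviation stays as a
function of `x`, the difference of means costs the factor in `|k - j|`, and the last deviation is
integrated by Hölder. -/
theorem MemBMO.exists_lintegral_annulus_le {b : EuclideanSpace ℝ (Fin n) → 𝕜} (hb : MemBMO b)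
    {q : Fin n → ℝ} (hq : ∀ i, 1 < q i) :
    ∃ C : ℝ≥0∞, C ≠ ∞ ∧ ∀ f : EuclideanSpace ℝ (Fin n) → 𝕜, AEStronglyMeasurable f volume →
      ∀ (j k : ℤ) (x : EuclideanSpace ℝ (Fin n)),
        ∫⁻ y in annulus n j, ‖b x - b y‖ₑ * ‖f y‖ₑ ≤
          C * (‖b x - ballMean b k‖ₑ + 1) * ((1 + (k - j).natAbs : ℕ) : ℝ≥0∞) *
            2 ^ ((j : ℝ) * (n - ∑ i, 1 / q i)) * mixedNorm q ((annulus n j).indicator f) := by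
  obtain ⟨C₁, hC₁, h1⟩ := hb.exists_ballMean_sub_le
  obtain ⟨C₂, hC₂, h2⟩ := hb.exists_setLIntegral_le hq
  refine ⟨(1 + C₁) * C₂, ENNReal.mul_ne_top (by simp [hC₁]) hC₂, fun f hf j k x => ?_⟩
  set X := ‖b x - ballMean b k‖ₑ with hX
  set N : ℝ≥0∞ := ((1 + (k - j).natAbs : ℕ) : ℝ≥0∞) with hN
  have hpt : ∀ y, ‖b x - b y‖ₑ * ‖f y‖ₑ ≤
      ((X + 1) * ((1 + C₁) * N)) * ((‖b y - ballMean b j‖ₑ + 1) * ‖f y‖ₑ) := by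
    intro y
    rw [← mul_assoc]
    gcongr
    have e : b x - b y = (b x - ballMean b k) + (ballMean b k - ballMean b j) +
        -(b y - ballMean b j) := by abel
    have h3 : ‖b x - b y‖ₑ ≤ X + C₁ * (k - j).natAbs + ‖b y - ballMean b j‖ₑ := by
      rw [e]
      refine (enorm_add_le _ _).trans ?_
      rw [enorm_neg]
      gcongr
      exact (enorm_add_le _ _).trans (by gcongr; exact h1 k j)
    refine h3.trans ?_
    set Y := ‖b y - ballMean b j‖ₑ
    set m : ℝ≥0∞ := ((k - j).natAbs : ℝ≥0∞)
    have hNm : N = 1 + m := by rw [hN]; push_cast; rfl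
    rw [hNm]
    have e2 : (X + 1) * ((1 + C₁) * (1 + m)) * (Y + 1) = (X + C₁ * m + Y) +
        (X * (m + C₁ + C₁ * m) + (1 + m + C₁) +
          Y * ((X + 1) * (m + C₁ + C₁ * m) + X)) := by ring
    rw [e2]
    exact le_self_add
  by_cases hX1 : (X + 1) * ((1 + C₁) * N) = ∞
  · exact absurd hX1 (ENNReal.mul_ne_top (by simp [hX]) (ENNReal.mul_ne_top (by simp [hC₁])
      (ENNReal.natCast_ne_top _)))
  calc _ ≤ ∫⁻ y in annulus n j,
        ((X + 1) * ((1 + C₁) * N)) * ((‖b y - ballMean b j‖ₑ + 1) * ‖f y‖ₑ) :=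
        lintegral_mono hpt
    _ = ((X + 1) * ((1 + C₁) * N)) *
        ∫⁻ y in annulus n j, (‖b y - ballMean b j‖ₑ + 1) * ‖f y‖ₑ := lintegral_const_mul' _ _ hX1
    _ ≤ ((X + 1) * ((1 + C₁) * N)) * (C₂ * 2 ^ ((j : ℝ) * (n - ∑ i, 1 / q i)) *
        mixedNorm q ((annulus n j).indicator f)) := by
        gcongr
        exact h2 f hf j _ (measurableSet_annulus n j) (annulus_subset_dyadicBall n j)
    _ = _ := by ring

/-- The singular integral of the commutator type over a set separated from `x`. -/
theorem MemBMO.exists_lintegral_kernel_le {b : EuclideanSpace ℝ (Fin n) → 𝕜} (hb : MemBMO b)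
    (hn : 1 ≤ n) {q : Fin n → ℝ} (hq : ∀ i, 1 < q i) :
    ∃ C : ℝ≥0∞, C ≠ ∞ ∧ ∀ f : EuclideanSpace ℝ (Fin n) → 𝕜, AEStronglyMeasurable f volume →
      ∀ (k : ℤ) (x : EuclideanSpace ℝ (Fin n)) (s : Set (EuclideanSpace ℝ (Fin n))),
        MeasurableSet s →
        (∀ j : ℤ, ∀ y ∈ annulus n j ∩ s, (2 : ℝ) ^ (max j k - 2) ≤ ‖x - y‖) →
        ∫⁻ y in s, ‖b x - b y‖ₑ * ‖f y‖ₑ / ‖x - y‖ₑ ^ n ≤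
          C * (‖b x - ballMean b k‖ₑ + 1) * (2 ^ (-((k : ℝ) * ∑ i, 1 / q i)) *
            ∑' j : ℤ, annulusWeight (∑ i, 1 / q i) n (k - j) *
              mixedNorm q ((annulus n j).indicator f)) := by
  obtain ⟨C, hC, hann⟩ := hb.exists_lintegral_annulus_le hq
  set Q := ∑ i, 1 / q i with hQ
  refine ⟨2 ^ (2 * (n : ℝ)) * C, ENNReal.mul_ne_top (two_rpow_ne_top _) hC,
    fun f hf k x s hs hsep => ?_⟩
  set X := ‖b x - ballMean b k‖ₑ with hX
  have : Nonempty (Fin n) := ⟨⟨0, hn⟩⟩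
  -- The annuli miss only the origin, which is null because `n` is positive.
  have hcover : s ≤ᵐ[volume] ⋃ j : ℤ, annulus n j ∩ s := by
    have h0 : ∀ᵐ x : EuclideanSpace ℝ (Fin n), x ≠ 0 := by
      simp [ae_iff]
    filter_upwards [h0] with y hy hys
    obtain ⟨j, hj⟩ := exists_mem_annulus hy
    exact Set.mem_iUnion.2 ⟨j, hj, hys⟩
  have hterm : ∀ j : ℤ, ∫⁻ y in annulus n j ∩ s, ‖b x - b y‖ₑ * ‖f y‖ₑ / ‖x - y‖ₑ ^ n ≤
      2 ^ (2 * (n : ℝ)) * C * (X + 1) * (2 ^ (-((k : ℝ) * Q)) *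
        (annulusWeight Q n (k - j) * mixedNorm q ((annulus n j).indicator f))) := by
    intro j
    set e : ℝ := -(((max j k - 2 : ℤ) : ℝ) * n) with he
    have hpt : ∀ y ∈ annulus n j ∩ s, ‖b x - b y‖ₑ * ‖f y‖ₑ / ‖x - y‖ₑ ^ n ≤
        2 ^ e * (‖b x - b y‖ₑ * ‖f y‖ₑ) := by
      intro y hy
      rw [div_eq_mul_inv, mul_comm]
      gcongr
      rw [he, ENNReal.rpow_neg, ENNReal.inv_le_inv, ENNReal.rpow_mul, ENNReal.rpow_natCast]
      gcongr
      rw [← ofReal_two_zpow, ← ofReal_norm]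
      exact ENNReal.ofReal_le_ofReal (hsep j y hy)
    calc _ ≤ ∫⁻ y in annulus n j ∩ s, 2 ^ e * (‖b x - b y‖ₑ * ‖f y‖ₑ) :=
          setLIntegral_mono' ((measurableSet_annulus n j).inter hs) hpt
      _ ≤ ∫⁻ y in annulus n j, 2 ^ e * (‖b x - b y‖ₑ * ‖f y‖ₑ) :=
          lintegral_mono_set Set.inter_subset_left
      _ = 2 ^ e * ∫⁻ y in annulus n j, ‖b x - b y‖ₑ * ‖f y‖ₑ :=
          lintegral_const_mul' _ _ (two_rpow_ne_top _)
      _ ≤ 2 ^ e * (C * (X + 1) * ((1 + (k - j).natAbs : ℕ) : ℝ≥0∞) *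
            2 ^ ((j : ℝ) * (n - Q)) * mixedNorm q ((annulus n j).indicator f)) := by
          gcongr
          exact hann f hf j k x
      _ = (2 ^ e * 2 ^ ((j : ℝ) * (n - Q))) * (C * (X + 1) *
            ((1 + (k - j).natAbs : ℕ) : ℝ≥0∞) * mixedNorm q ((annulus n j).indicator f)) := by
          ring
      _ = (2 ^ (2 * (n : ℝ)) * 2 ^ (-((k : ℝ) * Q)) *
            2 ^ (((k - j : ℤ) : ℝ) * Q - max ((k - j : ℤ) : ℝ) 0 * n)) * (C * (X + 1) *
            ((1 + (k - j).natAbs : ℕ) : ℝ≥0∞) * mixedNorm q ((annulus n j).indicator f)) := by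
          congr 1
          rw [← two_rpow_add, ← two_rpow_add, ← two_rpow_add, he]
          congr 1
          push_cast
          -- This turns the separation of `x` and `y` into a function of `k - j`, which makes the
          -- estimate a convolution.
          have hmax : max (j : ℝ) k = j + max ((k : ℝ) - j) 0 := by
            rcases le_total (j : ℝ) k with h | h
            · rw [max_eq_right h, max_eq_left (by linarith)]; ring
            · rw [max_eq_left h, max_eq_right (by linarith)]; ring
          rw [hmax]; ring
      _ = _ := by
          unfold annulusWeight; ring
  calc _ ≤ ∫⁻ y in ⋃ j : ℤ, annulus n j ∩ s, ‖b x - b y‖ₑ * ‖f y‖ₑ / ‖x - y‖ₑ ^ n :=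
        lintegral_mono_set' hcover
    _ ≤ ∑' j : ℤ, ∫⁻ y in annulus n j ∩ s, ‖b x - b y‖ₑ * ‖f y‖ₑ / ‖x - y‖ₑ ^ n :=
        lintegral_iUnion_le _ _
    _ ≤ _ := ENNReal.tsum_le_tsum hterm
    _ = _ := by rw [ENNReal.tsum_mul_left, ENNReal.tsum_mul_left]

end BMO

/-! ### Commutators of sublinear operators -/

section Commutator

variable {𝕜 : Type*} [RCLike 𝕜] {n : ℕ} {b : EuclideanSpace ℝ (Fin n) → 𝕜}
  {D : Submodule 𝕜 (EuclideanSpace ℝ (Fin n) → 𝕜)}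
  {T : (EuclideanSpace ℝ (Fin n) → 𝕜) → EuclideanSpace ℝ (Fin n) → 𝕜}

/-- The functions (b(x) - b) u all lie in the span of `u` and `b u`, whatever `x` is, so a single
null set from `SublinearOn` serves every choice of the constant. -/
theorem mul_sub_mem_span {F : Set (EuclideanSpace ℝ (Fin n) → 𝕜)}
    {u : EuclideanSpace ℝ (Fin n) → 𝕜} (hu : u ∈ F) (hbu : (fun y => b y * u y) ∈ F) (c : 𝕜) :
    (fun y => (c - b y) * u y) ∈ Submodule.span 𝕜 F := by
  have : (fun y => (c - b y) * u y) = c • u - fun y => b y * u y := by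
    funext y
    simp [sub_mul]
  rw [this]
  exact Submodule.sub_mem _ (Submodule.smul_mem _ _ (Submodule.subset_span hu))
    (Submodule.subset_span hbu)

theorem commutatorDomain_sub {u v : EuclideanSpace ℝ (Fin n) → 𝕜}
    (hu : u ∈ commutatorDomain D b) (hv : v ∈ commutatorDomain D b) :
    u - v ∈ commutatorDomain D b := by
  refine ⟨D.sub_mem hu.1 hv.1, ?_⟩
  have : (fun y => b y * (u - v) y) = (fun y => b y * u y) - fun y => b y * v y := by
    funext y; simp [mul_sub]
  rw [this]
  exact D.sub_mem hu.2 hv.2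

theorem SublinearOn.norm_commutator_add_le (hT : SublinearOn D T)
    {u v : EuclideanSpace ℝ (Fin n) → 𝕜}
    (hu : u ∈ commutatorDomain D b) (hv : v ∈ commutatorDomain D b) :
    ∀ᵐ x, ‖commutator b T (u + v) x‖ ≤ ‖commutator b T u x‖ + ‖commutator b T v x‖ := by
  set F : Set (EuclideanSpace ℝ (Fin n) → 𝕜) :=
    {u, fun y => b y * u y, v, fun y => b y * v y} with hF
  have hFD : F ⊆ D := by
    rintro g (rfl | rfl | rfl | rfl)
    exacts [hu.1, hu.2, hv.1, hv.2]
  filter_upwards [hT F (Set.toFinite F) hFD] with x hx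
  have := hx.1 _ (mul_sub_mem_span (F := F) (b := b) (u := u) (by simp [hF]) (by simp [hF]) (b x))
    _ (mul_sub_mem_span (F := F) (b := b) (u := v) (by simp [hF]) (by simp [hF]) (b x))
  refine le_trans (le_of_eq ?_) this
  unfold commutator
  congr 2
  funext y
  simp [mul_add]

theorem SublinearOn.norm_commutator_neg (hT : SublinearOn D T)
    {u : EuclideanSpace ℝ (Fin n) → 𝕜} (hu : u ∈ commutatorDomain D b) :
    ∀ᵐ x, ‖commutator b T (-u) x‖ = ‖commutator b T u x‖ := by
  set F : Set (EuclideanSpace ℝ (Fin n) → 𝕜) := {u, fun y => b y * u y} with hF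
  have hFD : F ⊆ D := by
    rintro g (rfl | rfl)
    exacts [hu.1, hu.2]
  filter_upwards [hT F (Set.toFinite F) hFD] with x hx
  have := hx.2 _ (mul_sub_mem_span (F := F) (b := b) (u := u) (by simp [hF]) (by simp [hF]) (b x))
    (-1)
  rw [norm_neg, norm_one, one_mul] at this
  rw [commutator, commutator, ← this]
  congr 2
  funext y
  simp

theorem SublinearOn.abs_norm_commutator_sub_le (hT : SublinearOn D T)
    {u v : EuclideanSpace ℝ (Fin n) → 𝕜}
    (hu : u ∈ commutatorDomain D b) (hv : v ∈ commutatorDomain D b) :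
    ∀ᵐ x, |‖commutator b T u x‖ - ‖commutator b T v x‖| ≤ ‖commutator b T (u - v) x‖ := by
  filter_upwards [hT.norm_commutator_add_le (commutatorDomain_sub hu hv) hv,
    hT.norm_commutator_add_le (commutatorDomain_sub hv hu) hu,
    hT.norm_commutator_neg (commutatorDomain_sub hu hv)] with x h1 h2 h3
  rw [sub_add_cancel] at h1 h2
  rw [neg_sub] at h3
  rw [h3] at h2
  exact abs_sub_le_iff.2 ⟨by linarith, by linarith⟩

/-- A point outside the support has positive distance from it, so the kernel is bounded there.
Finiteness makes the error term in the next argument continuous in the constant. -/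
theorem lintegral_div_enorm_pow_ne_top {u : EuclideanSpace ℝ (Fin n) → 𝕜} (hu : Integrable u)
    {x : EuclideanSpace ℝ (Fin n)} (hx : x ∉ tsupport u) :
    ∫⁻ y, ‖u y‖ₑ / ‖x - y‖ₑ ^ n ≠ ∞ := by
  obtain ⟨δ, hδ, hδx⟩ := Metric.isOpen_iff.1 (isClosed_tsupport u).isOpen_compl x hx
  have h0 : ENNReal.ofReal δ ^ n ≠ 0 := pow_ne_zero _ (by simpa using hδ)
  have h1 : ∫⁻ y, ‖u y‖ₑ / ‖x - y‖ₑ ^ n ≤ ∫⁻ y, (ENNReal.ofReal δ ^ n)⁻¹ * ‖u y‖ₑ := by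
    refine lintegral_mono fun y => ?_
    by_cases hy : u y = 0
    · simp [hy]
    · rw [div_eq_mul_inv, mul_comm]
      gcongr
      rw [← ofReal_norm]
      refine ENNReal.ofReal_le_ofReal (not_lt.1 fun hlt => ?_)
      have hmem : y ∈ Metric.ball x δ := by rwa [Metric.mem_ball, dist_comm, dist_eq_norm]
      exact hδx hmem (subset_tsupport u hy)
  refine ne_top_of_le_ne_top ?_ h1
  rw [lintegral_const_mul' _ _ (ENNReal.inv_ne_top.2 h0)]
  exact ENNReal.mul_ne_top (ENNReal.inv_ne_top.2 h0) hu.2.ne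

/-- The size condition passes to the commutator. -/
theorem SublinearOn.enorm_commutator_le (hT : SublinearOn D T)
    (hD : ∀ f : EuclideanSpace ℝ (Fin n) → 𝕜, Integrable f volume → HasCompactSupport f → f ∈ D)
    {C : ℝ≥0} (hC : ∀ f : EuclideanSpace ℝ (Fin n) → 𝕜, Integrable f volume →
      HasCompactSupport f → ∀ᵐ x : EuclideanSpace ℝ (Fin n), x ∉ tsupport f →
        ‖T f x‖ₑ ≤ (C : ℝ≥0∞) * ∫⁻ y, ‖f y‖ₑ / ‖x - y‖ₑ ^ n)
    {u : EuclideanSpace ℝ (Fin n) → 𝕜} (hu : Integrable u) (huc : HasCompactSupport u)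
    (hbu : Integrable fun y => b y * u y) :
    ∀ᵐ x, x ∉ tsupport u →
      ‖commutator b T u x‖ₑ ≤ (C : ℝ≥0∞) * ∫⁻ y, ‖b x - b y‖ₑ * ‖u y‖ₑ / ‖x - y‖ₑ ^ n := by
  set F : Set (EuclideanSpace ℝ (Fin n) → 𝕜) := {u, fun y => b y * u y} with hF
  have hFD : F ⊆ D := by
    rintro g (rfl | rfl)
    exacts [hD _ hu huc, hD _ hbu huc.mul_left]
  -- The null set of the size condition depends on the function, so the condition cannot be applied
  -- directly to (b(x) - b) u. It is used for countably many constants `e i`, and b(x) is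
  -- approximated by them.
  set e := TopologicalSpace.denseSeq 𝕜 with he
  have hsize : ∀ᵐ x, ∀ i : ℕ, x ∉ tsupport u →
      ‖T (fun y => (e i - b y) * u y) x‖ₑ ≤
        (C : ℝ≥0∞) * ∫⁻ y, ‖(e i - b y) * u y‖ₑ / ‖x - y‖ₑ ^ n := by
    rw [ae_all_iff]
    intro i
    have hint : Integrable fun y => (e i - b y) * u y := by
      refine ((hu.const_mul (e i)).sub hbu).congr (ae_of_all _ fun y => ?_)
      simp [sub_mul]
    filter_upwards [hC _ hint huc.mul_left] with x hx hxu
    exact hx fun h => hxu (closure_mono (Function.support_mul_subset_right _ _) h)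
  filter_upwards [hT F (Set.toFinite F) hFD, hsize] with x hsub hx hxu
  set W := ∫⁻ y, ‖u y‖ₑ / ‖x - y‖ₑ ^ n with hW
  have hW1 : W ≠ ∞ := lintegral_div_enorm_pow_ne_top hu hxu
  set I := ∫⁻ y, ‖b x - b y‖ₑ * ‖u y‖ₑ / ‖x - y‖ₑ ^ n with hI
  set Z := ‖T u x‖ₑ + (C : ℝ≥0∞) * W with hZ
  have hZ1 : Z ≠ ∞ := ENNReal.add_ne_top.2 ⟨by simp, ENNReal.mul_ne_top (by simp) hW1⟩
  -- Replacing b(x) by `c` costs at most a finite multiple of ‖b x - c‖. The bound is closed in `c`,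
  -- extends from the dense sequence, and is evaluated at `c = b x`.
  have key : ∀ c : 𝕜, ‖commutator b T u x‖ₑ ≤ C * I + Z * ‖b x - c‖ₑ := by
    intro c
    refine (TopologicalSpace.denseRange_denseSeq 𝕜).induction_on
      (p := fun c => ‖commutator b T u x‖ₑ ≤ C * I + Z * ‖b x - c‖ₑ) c ?_ fun i => ?_
    · refine isClosed_le continuous_const (continuous_const.add ?_)
      exact (ENNReal.continuous_const_mul hZ1).comp (continuous_const.sub continuous_id).enorm
    · have h1 : ‖commutator b T u x‖ ≤
          ‖b x - e i‖ * ‖T u x‖ + ‖T (fun y => (e i - b y) * u y) x‖ := by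
        have hus : u ∈ Submodule.span 𝕜 F := Submodule.subset_span (by simp [hF])
        have h2 := hsub.1 _ (Submodule.smul_mem _ (b x - e i) hus) _
          (mul_sub_mem_span (F := F) (b := b) (u := u) (by simp [hF]) (by simp [hF]) (e i))
        rw [hsub.2 u hus] at h2
        refine le_trans (le_of_eq ?_) h2
        unfold commutator
        congr 2
        funext y
        simp only [Pi.add_apply, Pi.smul_apply, smul_eq_mul]
        ring
      have h3 : ‖commutator b T u x‖ₑ ≤
          ‖b x - e i‖ₑ * ‖T u x‖ₑ + ‖T (fun y => (e i - b y) * u y) x‖ₑ := by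
        simp only [← ofReal_norm]
        rw [← ENNReal.ofReal_mul (norm_nonneg _),
          ← ENNReal.ofReal_add (by positivity) (norm_nonneg _)]
        exact ENNReal.ofReal_le_ofReal h1
      have h4 : ∫⁻ y, ‖(e i - b y) * u y‖ₑ / ‖x - y‖ₑ ^ n ≤ I + ‖b x - e i‖ₑ * W := by
        have hWm : AEMeasurable (fun y => ‖u y‖ₑ / ‖x - y‖ₑ ^ n) :=
          hu.1.enorm.div (by fun_prop)
        rw [hW, ← lintegral_const_mul' _ _ (by simp), hI,
          ← lintegral_add_right' _ (hWm.const_mul _)]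
        refine lintegral_mono fun y => ?_
        rw [enorm_mul, ← mul_div_assoc, ← ENNReal.add_div, ← add_mul]
        gcongr
        rw [← enorm_neg (b x - e i), add_comm]
        refine le_trans (le_of_eq ?_) (enorm_add_le _ _)
        congr 1; ring
      calc _ ≤ _ := h3
        _ ≤ ‖b x - e i‖ₑ * ‖T u x‖ₑ + C * (I + ‖b x - e i‖ₑ * W) := by
          gcongr
          exact (hx i hxu).trans (by gcongr)
        _ = _ := by rw [hZ]; ring
  simpa using key (b x)

/-- Truncations of locally mixed integrable functions lie in the domain of the commutator. -/
theorem MemBMO.integrable_indicator (hb : MemBMO b) {q : Fin n → ℝ} (hq : ∀ i, 1 < q i)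
    {f : EuclideanSpace ℝ (Fin n) → 𝕜} (hf : MemMixedLpLoc q f) {N : ℤ}
    {s : Set (EuclideanSpace ℝ (Fin n))} (hs : MeasurableSet s) (hsub : s ⊆ dyadicBall n N) :
    Integrable (s.indicator f) ∧ Integrable (fun y => b y * s.indicator f y) ∧
      HasCompactSupport (s.indicator f) ∧ MemMixedLp q (s.indicator f) := by
  obtain ⟨C, hC, hint⟩ := hb.exists_setLIntegral_le hq
  have hcomp : IsCompact (dyadicBall n N) := by
    rw [dyadicBall_eq_closedBall]; exact isCompact_closedBall _ _
  have hnorm : mixedNorm q (s.indicator f) < ∞ := by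
    refine lt_of_le_of_lt ?_ (hf.2 _ hcomp)
    rw [mixedNorm_indicator_eq, mixedNorm_indicator_eq]
    exact mixedENorm_mono hq fun x => Set.indicator_le_indicator_of_subset hsub
      (fun _ => zero_le) x
  have hsm : AEStronglyMeasurable (s.indicator f) volume := hf.1.indicator hs
  have hbsm : AEStronglyMeasurable (fun y => b y * s.indicator f y) volume :=
    hb.1.aestronglyMeasurable.mul hsm
  have hfin : ∫⁻ y in s, (‖b y - ballMean b N‖ₑ + 1) * ‖f y‖ₑ < ∞ :=
    lt_of_le_of_lt (hint f hf.1 N s hs hsub)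
      (ENNReal.mul_lt_top (ENNReal.mul_lt_top hC.lt_top (two_rpow_ne_top _).lt_top) hnorm)
  have hw : ∀ y, s.indicator (fun y => (‖b y - ballMean b N‖ₑ + 1) * ‖f y‖ₑ) y =
      (‖b y - ballMean b N‖ₑ + 1) * ‖s.indicator f y‖ₑ := by
    intro y
    by_cases hy : y ∈ s <;> simp [hy]
  rw [← lintegral_indicator hs] at hfin
  simp_rw [hw] at hfin
  refine ⟨⟨hsm, ?_⟩, ⟨hbsm, ?_⟩, ?_, hsm, hnorm⟩
  · refine lt_of_le_of_lt (lintegral_mono fun y => ?_) hfin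
    exact le_mul_of_one_le_left zero_le le_add_self
  · refine lt_of_le_of_lt (b := ∫⁻ y, (1 + ‖ballMean b N‖ₑ) *
      ((‖b y - ballMean b N‖ₑ + 1) * ‖s.indicator f y‖ₑ)) (lintegral_mono fun y => ?_) ?_
    · rw [enorm_mul, ← mul_assoc]
      gcongr
      have h1 : ‖b y‖ₑ ≤ ‖b y - ballMean b N‖ₑ + ‖ballMean b N‖ₑ := by
        refine le_trans (le_of_eq ?_) (enorm_add_le _ _)
        rw [sub_add_cancel]
      refine h1.trans ?_
      have h2 : (1 + ‖ballMean b N‖ₑ) * (‖b y - ballMean b N‖ₑ + 1) =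
          (‖b y - ballMean b N‖ₑ + ‖ballMean b N‖ₑ) +
            (1 + ‖ballMean b N‖ₑ * ‖b y - ballMean b N‖ₑ) := by ring
      rw [h2]
      exact le_self_add
    · rw [lintegral_const_mul' _ _ (by simp)]
      exact ENNReal.mul_lt_top (by simp) hfin
  · exact HasCompactSupport.intro hcomp fun x hx => Set.indicator_of_notMem (fun h => hx (hsub h)) _

theorem MemBMO.indicator_mem_commutatorDomain (hb : MemBMO b) {q : Fin n → ℝ} (hq : ∀ i, 1 < q i)
    (hD : ∀ f : EuclideanSpace ℝ (Fin n) → 𝕜, Integrable f volume → HasCompactSupport f → f ∈ D)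
    {f : EuclideanSpace ℝ (Fin n) → 𝕜} (hf : MemMixedLpLoc q f) {N : ℤ}
    {s : Set (EuclideanSpace ℝ (Fin n))} (hs : MeasurableSet s) (hsub : s ⊆ dyadicBall n N) :
    s.indicator f ∈ commutatorDomain D b := by
  obtain ⟨h1, h2, h3, -⟩ := hb.integrable_indicator hq hf hs hsub
  exact ⟨hD _ h1 h3, hD _ h2 h3.mul_left⟩

end Commutator

/-! ### Separation of dyadic balls and annuli -/

section Separation

variable {n : ℕ}

theorem mem_compl_dyadicBall_iff {k : ℤ} {x : EuclideanSpace ℝ (Fin n)} :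
    x ∈ (dyadicBall n k)ᶜ ↔ (2 : ℝ) ^ k < ‖x‖ := by
  simp [dyadicBall]

theorem dyadicBall_mono {j k : ℤ} (h : j ≤ k) : dyadicBall n j ⊆ dyadicBall n k :=
  fun x (hx : ‖x‖ ≤ (2 : ℝ) ^ j) => hx.trans (zpow_le_zpow_right₀ one_le_two h)

/-- The gap of one shell forces `j ≥ k + 2`, so ‖x‖ is at most half of the lower bound 2^(j-1) for
‖y‖. -/
theorem le_norm_sub_of_mem_dyadicBall {j k : ℤ} {x y : EuclideanSpace ℝ (Fin n)}
    (hx : x ∈ dyadicBall n k) (hy : y ∈ annulus n j ∩ (dyadicBall n (k + 1))ᶜ) :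
    (2 : ℝ) ^ (max j k - 2) ≤ ‖x - y‖ := by
  have h1 := mem_annulus_iff.1 hy.1
  have h2 := mem_compl_dyadicBall_iff.1 hy.2
  have hjk : k + 1 < j := (zpow_lt_zpow_iff_right₀ one_lt_two).1 (h2.trans_le h1.1)
  rw [max_eq_left (by omega)]
  have hx' : ‖x‖ ≤ (2 : ℝ) ^ (j - 2) := hx.trans (zpow_le_zpow_right₀ one_le_two (by omega))
  have h3 : (2 : ℝ) ^ (j - 1) = 2 * 2 ^ (j - 2) := by
    rw [← zpow_one_add₀ two_ne_zero]; congr 1; ring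
  rw [norm_sub_rev]
  have := norm_sub_norm_le y x
  linarith [h1.2]

theorem le_norm_sub_of_mem_annulus {j k : ℤ} {x y : EuclideanSpace ℝ (Fin n)}
    (hx : x ∈ annulus n k)
    (hy : y ∈ annulus n j ∩ (dyadicBall n (k - 2) ∪ (dyadicBall n (k + 1))ᶜ)) :
    (2 : ℝ) ^ (max j k - 2) ≤ ‖x - y‖ := by
  rcases hy.2 with h | h
  · have h1 := mem_annulus_iff.1 hy.1
    have h' : ‖y‖ ≤ (2 : ℝ) ^ (k - 2) := h
    have hjk : j - 1 < k - 2 := (zpow_lt_zpow_iff_right₀ one_lt_two).1 (h1.2.trans_le h')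
    rw [max_eq_right (by omega)]
    have h3 : (2 : ℝ) ^ (k - 1) = 2 * 2 ^ (k - 2) := by
      rw [← zpow_one_add₀ two_ne_zero]; congr 1; ring
    have := norm_sub_norm_le x y
    linarith [(mem_annulus_iff.1 hx).2]
  · exact le_norm_sub_of_mem_dyadicBall (annulus_subset_dyadicBall n k hx) ⟨hy.1, h⟩

theorem closure_compl_dyadicBall_subset (k : ℤ) :
    closure (dyadicBall n k)ᶜ ⊆ {x | (2 : ℝ) ^ k ≤ ‖x‖} :=
  closure_minimal (fun _ hx => (mem_compl_dyadicBall_iff.1 hx).le)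
    (isClosed_le continuous_const continuous_norm)

theorem notMem_closure_compl_dyadicBall {k m : ℤ} (hkm : k < m) {x : EuclideanSpace ℝ (Fin n)}
    (hx : x ∈ dyadicBall n k) : x ∉ closure (dyadicBall n m)ᶜ := fun h =>
  absurd ((closure_compl_dyadicBall_subset m h).trans hx)
    (not_le.2 (zpow_lt_zpow_right₀ (one_lt_two (α := ℝ)) hkm))

theorem notMem_closure_of_mem_annulus {k : ℤ} {x : EuclideanSpace ℝ (Fin n)}
    (hx : x ∈ annulus n k) : x ∉ closure (dyadicBall n (k - 2) ∪ (dyadicBall n (k + 1))ᶜ) := by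
  rw [closure_union, (isClosed_dyadicBall n (k - 2)).closure_eq]
  rintro (h | h)
  · exact hx.2 (dyadicBall_mono (by omega) h)
  · exact notMem_closure_compl_dyadicBall (by omega) (annulus_subset_dyadicBall n k hx) h

theorem exists_nat_mem_dyadicBall (x : EuclideanSpace ℝ (Fin n)) : ∃ k : ℕ, x ∈ dyadicBall n k := by
  obtain ⟨k, hk⟩ := pow_unbounded_of_one_lt ‖x‖ (one_lt_two (α := ℝ))
  exact ⟨k, by simpa [dyadicBall] using hk.le⟩

theorem tsupport_indicator_subset {𝕜 : Type*} [RCLike 𝕜] (s : Set (EuclideanSpace ℝ (Fin n)))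
    (f : EuclideanSpace ℝ (Fin n) → 𝕜) : tsupport (s.indicator f) ⊆ closure s :=
  closure_mono Set.support_indicator_subset

end Separation

/-! ### Truncations -/

section Truncation

variable {𝕜 : Type*} [RCLike 𝕜] {n : ℕ} {b : EuclideanSpace ℝ (Fin n) → 𝕜}
  {D : Submodule 𝕜 (EuclideanSpace ℝ (Fin n) → 𝕜)}
  {T : (EuclideanSpace ℝ (Fin n) → 𝕜) → EuclideanSpace ℝ (Fin n) → 𝕜} {q : Fin n → ℝ}

/-- The weighted sum of the norms on annuli that dominates the commutator on the annulus of index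
`k`. -/
noncomputable def annulusSum (q : Fin n → ℝ) (f : EuclideanSpace ℝ (Fin n) → 𝕜) (k : ℤ) : ℝ≥0∞ :=
  ∑' j : ℤ, annulusWeight (∑ i, 1 / q i) n (k - j) * mixedNorm q ((annulus n j).indicator f)

theorem setLIntegral_kernel_indicator_le {s t : Set (EuclideanSpace ℝ (Fin n))} (hst : s ⊆ t)
    (ht : MeasurableSet t) (f : EuclideanSpace ℝ (Fin n) → 𝕜) (x : EuclideanSpace ℝ (Fin n)) :
    ∫⁻ y, ‖b x - b y‖ₑ * ‖s.indicator f y‖ₑ / ‖x - y‖ₑ ^ n ≤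
      ∫⁻ y in t, ‖b x - b y‖ₑ * ‖f y‖ₑ / ‖x - y‖ₑ ^ n := by
  rw [← lintegral_indicator ht]
  refine lintegral_mono fun y => ?_
  by_cases hy : y ∈ s
  · simp [hy, hst hy]
  · simp [hy]

/-- Continuity from above of the measure with density `g`: the complements decrease to the empty set
and one of them has finite measure. -/
theorem tendsto_setLIntegral_compl_dyadicBall {g : EuclideanSpace ℝ (Fin n) → ℝ≥0∞}
    {k : ℕ} (hk : ∫⁻ y in (dyadicBall n k)ᶜ, g y ≠ ∞) :
    Tendsto (fun M : ℕ => ∫⁻ y in (dyadicBall n M)ᶜ, g y) atTop (𝓝 0) := by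
  have hm : ∀ M : ℕ, MeasurableSet (dyadicBall n (M : ℤ))ᶜ := fun M =>
    (measurableSet_dyadicBall n M).compl
  have h := tendsto_measure_iInter_atTop (μ := volume.withDensity g)
    (s := fun M : ℕ => (dyadicBall n (M : ℤ))ᶜ) (fun M => (hm M).nullMeasurableSet)
    (fun M N hMN => Set.compl_subset_compl.2 (dyadicBall_mono (by exact_mod_cast hMN)))
    ⟨k, by rwa [withDensity_apply _ (hm k)]⟩
  have hempty : ⋂ M : ℕ, (dyadicBall n (M : ℤ))ᶜ = ∅ := by
    rw [← Set.compl_iUnion, Set.compl_empty_iff]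
    exact Set.eq_univ_of_forall fun x => Set.mem_iUnion.2 (exists_nat_mem_dyadicBall x)
  rw [hempty, measure_empty] at h
  refine h.congr fun M => ?_
  simp only [Function.comp]
  rw [withDensity_apply _ (hm M)]

/-- Almost everywhere convergence of the absolute values of the commutator along truncations. -/
theorem exists_tendsto_norm_commutator (hn : 1 ≤ n) (hb : MemBMO b) (hq : ∀ i, 1 < q i)
    (hD : ∀ f : EuclideanSpace ℝ (Fin n) → 𝕜, Integrable f volume → HasCompactSupport f → f ∈ D)
    (hT : SublinearOn D T) (hTs : SizeCondition T)
    {f : EuclideanSpace ℝ (Fin n) → 𝕜} (hf : MemMixedLpLoc q f)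
    (hsum : ∀ k, annulusSum q f k ≠ ∞) :
    ∀ᵐ x, ∃ L : ℝ, Tendsto (fun N : ℕ => ‖commutator b T ((dyadicBall n (N : ℤ)).indicator f) x‖)
      atTop (𝓝 L) := by
  obtain ⟨C, hC⟩ := hTs
  obtain ⟨C', hC', hker⟩ := hb.exists_lintegral_kernel_le hn hq
  have hm : ∀ N : ℕ, MeasurableSet (dyadicBall n (N : ℤ)) := fun N => measurableSet_dyadicBall n N
  have hsub : ∀ᵐ x, ∀ M N : ℕ, |‖commutator b T ((dyadicBall n (M : ℤ)).indicator f) x‖ -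
      ‖commutator b T ((dyadicBall n (N : ℤ)).indicator f) x‖| ≤
      ‖commutator b T ((dyadicBall n (M : ℤ)).indicator f -
        (dyadicBall n (N : ℤ)).indicator f) x‖ := by
    rw [ae_all_iff]; intro M
    rw [ae_all_iff]; intro N
    exact hT.abs_norm_commutator_sub_le
      (hb.indicator_mem_commutatorDomain hq hD hf (hm M) le_rfl)
      (hb.indicator_mem_commutatorDomain hq hD hf (hm N) le_rfl)
  have hsize : ∀ᵐ x, ∀ M N : ℕ,
      x ∉ tsupport ((dyadicBall n (M : ℤ) \ dyadicBall n (N : ℤ)).indicator f) →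
      ‖commutator b T ((dyadicBall n (M : ℤ) \ dyadicBall n (N : ℤ)).indicator f) x‖ₑ ≤
        (C : ℝ≥0∞) * ∫⁻ y, ‖b x - b y‖ₑ *
          ‖(dyadicBall n (M : ℤ) \ dyadicBall n (N : ℤ)).indicator f y‖ₑ / ‖x - y‖ₑ ^ n := by
    rw [ae_all_iff]; intro M
    rw [ae_all_iff]; intro N
    obtain ⟨h1, h2, h3, -⟩ := hb.integrable_indicator hq hf ((hm M).diff (hm N))
      (Set.sdiff_subset (s := dyadicBall n (M : ℤ)))
    exact hT.enorm_commutator_le hD hC h1 h3 h2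
  filter_upwards [hsub, hsize] with x hx1 hx2
  obtain ⟨k, hk⟩ := exists_nat_mem_dyadicBall x
  set t : ℕ → ℝ≥0∞ := fun M => ∫⁻ y in (dyadicBall n (M : ℤ))ᶜ,
    ‖b x - b y‖ₑ * ‖f y‖ₑ / ‖x - y‖ₑ ^ n with ht
  -- Outside B_{k+1} the kernel bound applies with `x` in B_k, and its right side is finite by
  -- `hsum`.
  have htk : t (k + 1) ≠ ∞ := by
    refine ne_top_of_le_ne_top ?_ (hker f hf.1 k x _ (hm (k + 1)).compl fun j y hy =>
      le_norm_sub_of_mem_dyadicBall hk (by exact_mod_cast hy))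
    exact ENNReal.mul_ne_top (ENNReal.mul_ne_top hC' (by simp))
      (ENNReal.mul_ne_top (two_rpow_ne_top _) (hsum k))
  have htlim : Tendsto (fun M : ℕ => (C : ℝ≥0∞) * t (M + (k + 1))) atTop (𝓝 0) := by
    have h1 := tendsto_setLIntegral_compl_dyadicBall htk
    have h2 := ((tendsto_add_atTop_iff_nat (k + 1)).2 h1)
    have h3 := ENNReal.Tendsto.const_mul h2 (Or.inr (ENNReal.coe_ne_top (r := C)))
    rwa [mul_zero] at h3
  have hanti : ∀ M N : ℕ, M ≤ N → t N ≤ t M := fun M N h =>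
    lintegral_mono_set (Set.compl_subset_compl.2 (dyadicBall_mono (by exact_mod_cast h)))
  have htfin : ∀ M : ℕ, (C : ℝ≥0∞) * t (M + (k + 1)) ≠ ∞ := fun M =>
    ENNReal.mul_ne_top ENNReal.coe_ne_top (ne_top_of_le_ne_top htk (hanti _ _ (by omega)))
  -- The offset `k + 1` puts `x` away from the support of the difference of two truncations, so the
  -- size condition bounds it by a tail.
  have hdist : ∀ N m l : ℕ, N ≤ m → m ≤ l →
      |‖commutator b T ((dyadicBall n ((l + (k + 1) : ℕ) : ℤ)).indicator f) x‖ -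
        ‖commutator b T ((dyadicBall n ((m + (k + 1) : ℕ) : ℤ)).indicator f) x‖| ≤
      ((C : ℝ≥0∞) * t (N + (k + 1))).toReal := by
    intro N m l hNm hml
    refine (hx1 _ _).trans ?_
    rw [← Set.indicator_sdiff (dyadicBall_mono (by exact_mod_cast Nat.add_le_add_right hml _))]
    rw [← toReal_enorm]
    refine ENNReal.toReal_mono (htfin N) ?_
    refine (hx2 _ _ fun h => ?_).trans ?_
    · refine notMem_closure_compl_dyadicBall (k := k) (m := ((m + (k + 1) : ℕ) : ℤ)) (by omega) hk
        (closure_mono ?_ (tsupport_indicator_subset _ _ h))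
      exact fun y hy => hy.2
    · gcongr
      refine (setLIntegral_kernel_indicator_le (fun y hy => hy.2) (hm _).compl f x).trans ?_
      exact hanti (N + (k + 1)) (m + (k + 1)) (by omega)
  have hcauchy : CauchySeq fun N : ℕ =>
      ‖commutator b T ((dyadicBall n ((N + (k + 1) : ℕ) : ℤ)).indicator f) x‖ := by
    refine cauchySeq_of_le_tendsto_0 (fun N => ((C : ℝ≥0∞) * t (N + (k + 1))).toReal) ?_ ?_
    · intro l m N hl hm'
      rw [Real.dist_eq]
      rcases le_total m l with h | h
      · exact hdist N m l hm' h
      · rw [abs_sub_comm]; exact hdist N l m hl h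
    · have := (ENNReal.tendsto_toReal ENNReal.zero_ne_top).comp htlim
      exact this
  obtain ⟨L, hL⟩ := cauchySeq_tendsto_of_complete hcauchy
  exact ⟨L, (tendsto_add_atTop_iff_nat (k + 1)).1 hL⟩

/-- Splitting off the part of a truncation that is separated from the point of evaluation. -/
theorem exists_enorm_commutator_indicator_le (hn : 1 ≤ n) (hb : MemBMO b) (hq : ∀ i, 1 < q i)
    (hD : ∀ f : EuclideanSpace ℝ (Fin n) → 𝕜, Integrable f volume → HasCompactSupport f → f ∈ D)
    (hT : SublinearOn D T) (hTs : SizeCondition T) :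
    ∃ C : ℝ≥0∞, C ≠ ∞ ∧ ∀ f : EuclideanSpace ℝ (Fin n) → 𝕜, MemMixedLpLoc q f →
      ∀ (k N : ℤ) (s X : Set (EuclideanSpace ℝ (Fin n))), MeasurableSet s →
        (∀ x ∈ X, x ∉ closure s) →
        (∀ x ∈ X, ∀ j : ℤ, ∀ y ∈ annulus n j ∩ s, (2 : ℝ) ^ (max j k - 2) ≤ ‖x - y‖) →
        ∀ᵐ x, x ∈ X → ‖commutator b T ((dyadicBall n N).indicator f) x‖ₑ ≤
          ‖commutator b T ((dyadicBall n N \ s).indicator f) x‖ₑ +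
            C * (2 ^ (-((k : ℝ) * ∑ i, 1 / q i)) * annulusSum q f k) *
              (‖b x - ballMean b k‖ₑ + 1) := by
  obtain ⟨C, hC⟩ := hTs
  obtain ⟨C', hC', hker⟩ := hb.exists_lintegral_kernel_le hn hq
  refine ⟨C * C', ENNReal.mul_ne_top ENNReal.coe_ne_top hC', fun f hf k N s X hs hcl hsep => ?_⟩
  have hB := measurableSet_dyadicBall n N
  have hdom1 := hb.indicator_mem_commutatorDomain hq hD hf (hB.diff hs)
    (Set.sdiff_subset (s := dyadicBall n N) (t := s))
  have hdom2 := hb.indicator_mem_commutatorDomain hq hD hf (hB.inter hs)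
    (Set.inter_subset_left (s := dyadicBall n N) (t := s))
  obtain ⟨h1, h2, h3, -⟩ := hb.integrable_indicator hq hf (hB.inter hs)
    (Set.inter_subset_left (s := dyadicBall n N) (t := s))
  filter_upwards [hT.norm_commutator_add_le hdom1 hdom2, hT.enorm_commutator_le hD hC h1 h3 h2]
    with x hadd hsize hxX
  have hsplit : (dyadicBall n N \ s).indicator f + (dyadicBall n N ∩ s).indicator f =
      (dyadicBall n N).indicator f := by
    have := Set.indicator_union_of_disjoint (M := 𝕜)
      (Set.disjoint_sdiff_inter (s := dyadicBall n N) (t := s)) f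
    rw [Set.sdiff_union_inter] at this
    exact this.symm
  rw [hsplit] at hadd
  have hadd' : ‖commutator b T ((dyadicBall n N).indicator f) x‖ₑ ≤
      ‖commutator b T ((dyadicBall n N \ s).indicator f) x‖ₑ +
        ‖commutator b T ((dyadicBall n N ∩ s).indicator f) x‖ₑ := by
    simp only [← ofReal_norm]
    rw [← ENNReal.ofReal_add (norm_nonneg _) (norm_nonneg _)]
    exact ENNReal.ofReal_le_ofReal hadd
  refine hadd'.trans ?_
  gcongr
  refine (hsize fun h => hcl x hxX (closure_mono Set.inter_subset_right
    (tsupport_indicator_subset _ _ h))).trans ?_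
  calc _ ≤ (C : ℝ≥0∞) * (C' * (‖b x - ballMean b k‖ₑ + 1) *
        (2 ^ (-((k : ℝ) * ∑ i, 1 / q i)) * annulusSum q f k)) := by
        gcongr
        exact (setLIntegral_kernel_indicator_le Set.inter_subset_right hs f x).trans
          (hker f hf.1 k x s hs (hsep x hxX))
    _ = _ := by ring

/-- Local bound for a limit of commutators along truncations. -/
theorem exists_mixedNorm_indicator_le_of_tendsto (hn : 1 ≤ n) (hb : MemBMO b)
    (hq : ∀ i, 1 < q i)
    (hD : ∀ f : EuclideanSpace ℝ (Fin n) → 𝕜, Integrable f volume → HasCompactSupport f → f ∈ D)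
    (hT : SublinearOn D T) (hTs : SizeCondition T)
    (hbT : BoundedOnMixedLp q (commutatorDomain D b) (commutator b T)) :
    ∃ C : ℝ≥0∞, C ≠ ∞ ∧ ∀ f g : EuclideanSpace ℝ (Fin n) → 𝕜, MemMixedLpLoc q f →
      (∀ k, annulusSum q f k ≠ ∞) →
      (∀ᵐ x, Tendsto (fun N : ℕ => ‖commutator b T ((dyadicBall n (N : ℤ)).indicator f) x‖)
        atTop (𝓝 ‖g x‖)) →
      ∀ (k : ℤ) (s X r : Set (EuclideanSpace ℝ (Fin n))), MeasurableSet s →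
        X ⊆ dyadicBall n k → (∀ x ∈ X, x ∉ closure s) →
        (∀ x ∈ X, ∀ j : ℤ, ∀ y ∈ annulus n j ∩ s, (2 : ℝ) ^ (max j k - 2) ≤ ‖x - y‖) →
        (∀ᶠ N : ℕ in atTop, dyadicBall n (N : ℤ) \ s = r) →
        mixedNorm q (X.indicator g) ≤
          C * (mixedNorm q (r.indicator f) + annulusSum q f k) := by
  obtain ⟨A, hA⟩ := hbT
  obtain ⟨C₁, hC₁, h1⟩ := exists_enorm_commutator_indicator_le hn hb hq hD hT hTs
  obtain ⟨C₂, hC₂, h2⟩ := hb.exists_mixedENorm_le hq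
  refine ⟨A + C₁ * C₂, ENNReal.add_ne_top.2 ⟨ENNReal.coe_ne_top, ENNReal.mul_ne_top hC₁ hC₂⟩,
    fun f g hf hsum hlim k s X r hs hXk hcl hsep hr => ?_⟩
  obtain ⟨N₀, hN₀⟩ := eventually_atTop.1 hr
  have hrN := hN₀ N₀ le_rfl
  have hrm : MeasurableSet r := hrN ▸ (measurableSet_dyadicBall n N₀).diff hs
  have hrsub : r ⊆ dyadicBall n (N₀ : ℤ) := hrN ▸ Set.sdiff_subset
  have hdom := hb.indicator_mem_commutatorDomain hq hD hf hrm hrsub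
  obtain ⟨-, -, -, hmem⟩ := hb.integrable_indicator hq hf hrm hrsub
  obtain ⟨hcm, hcb⟩ := hA _ hdom hmem
  set c : ℝ≥0∞ := C₁ * (2 ^ (-((k : ℝ) * ∑ i, 1 / q i)) * annulusSum q f k) with hc
  have hc1 : c ≠ ∞ := ENNReal.mul_ne_top hC₁ (ENNReal.mul_ne_top (two_rpow_ne_top _) (hsum k))
  set B : EuclideanSpace ℝ (Fin n) → ℝ≥0∞ :=
    (dyadicBall n k).indicator fun x => ‖b x - ballMean b k‖ₑ + 1 with hB
  have hBm : AEMeasurable B :=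
    ((hb.1.aestronglyMeasurable.sub aestronglyMeasurable_const).enorm.add_const 1).indicator
      (measurableSet_dyadicBall n k)
  have hall : ∀ᵐ x, ∀ N : ℕ, x ∈ X →
      ‖commutator b T ((dyadicBall n (N : ℤ)).indicator f) x‖ₑ ≤
        ‖commutator b T ((dyadicBall n (N : ℤ) \ s).indicator f) x‖ₑ +
          c * (‖b x - ballMean b k‖ₑ + 1) := by
    rw [ae_all_iff]
    exact fun N => h1 f hf k N s X hs hcl hsep
  -- For large `N` the truncation off `s` is restriction to `r`, so the bound is independent of `N`
  -- and passes to the limit.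
  have hpt : ∀ᵐ x, X.indicator (fun x => ‖g x‖ₑ) x ≤
      ‖commutator b T (r.indicator f) x‖ₑ + c * B x := by
    filter_upwards [hlim, hall] with x hx hxN
    by_cases hxX : x ∈ X
    · rw [Set.indicator_of_mem hxX, hB, Set.indicator_of_mem (hXk hxX)]
      have hx' := ENNReal.tendsto_ofReal hx
      simp only [ofReal_norm] at hx'
      refine le_of_tendsto hx' ?_
      filter_upwards [hr] with N hN
      have := hxN N hxX
      rwa [hN] at this
    · simp [hxX]
  rw [mixedNorm_indicator_eq]
  calc _ ≤ mixedENorm q (fun x => ‖commutator b T (r.indicator f) x‖ₑ + c * B x) :=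
        mixedENorm_mono_ae hq hpt
    _ ≤ mixedNorm q (commutator b T (r.indicator f)) + c * mixedENorm q B := by
        rw [← mixedENorm_const_mul hq hc1]
        exact mixedENorm_add_le hq hcm.1.enorm (hBm.const_mul c)
    _ ≤ A * mixedNorm q (r.indicator f) + c * (C₂ * 2 ^ ((k : ℝ) * ∑ i, 1 / q i)) := by
        gcongr
        exact h2 k
    _ = A * mixedNorm q (r.indicator f) + C₁ * C₂ * ((2 ^ (-((k : ℝ) * ∑ i, 1 / q i)) *
          2 ^ ((k : ℝ) * ∑ i, 1 / q i)) * annulusSum q f k) := by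
        rw [hc]; ring
    _ = A * mixedNorm q (r.indicator f) + C₁ * C₂ * annulusSum q f k := by
        rw [← two_rpow_add]; simp
    _ ≤ (A + C₁ * C₂) * mixedNorm q (r.indicator f) + (A + C₁ * C₂) * annulusSum q f k := by
        gcongr
        · exact le_self_add
        · exact le_add_self
    _ = _ := by ring

/-- On functions in the mixed Lebesgue space, the commutator is the limit along truncations. -/
theorem tendsto_norm_commutator_of_memMixedLp (hb : MemBMO b) (hq : ∀ i, 1 < q i)
    (hD : ∀ f : EuclideanSpace ℝ (Fin n) → 𝕜, Integrable f volume → HasCompactSupport f → f ∈ D)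
    (hT : SublinearOn D T)
    (hbT : BoundedOnMixedLp q (commutatorDomain D b) (commutator b T))
    {f : EuclideanSpace ℝ (Fin n) → 𝕜} (hf : MemMixedLpLoc q f) (hfq : MemMixedLp q f)
    (hfD : f ∈ commutatorDomain D b)
    (hlim : ∀ᵐ x, ∃ L : ℝ, Tendsto (fun N : ℕ =>
      ‖commutator b T ((dyadicBall n (N : ℤ)).indicator f) x‖) atTop (𝓝 L)) :
    ∀ᵐ x, Tendsto (fun N : ℕ => ‖commutator b T ((dyadicBall n (N : ℤ)).indicator f) x‖)
      atTop (𝓝 ‖commutator b T f x‖) := by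
  obtain ⟨A, hA⟩ := hbT
  obtain ⟨C, hC, hint⟩ := hb.exists_setLIntegral_le hq
  set h : ℕ → EuclideanSpace ℝ (Fin n) → 𝕜 := fun N =>
    commutator b T (f - (dyadicBall n (N : ℤ)).indicator f) with hh
  have hdom : ∀ N : ℕ, (dyadicBall n (N : ℤ)).indicator f ∈ commutatorDomain D b := fun N =>
    hb.indicator_mem_commutatorDomain hq hD hf (measurableSet_dyadicBall n N) le_rfl
  have hcompl : ∀ N : ℕ, f - (dyadicBall n (N : ℤ)).indicator f =
      ((dyadicBall n (N : ℤ))ᶜ).indicator f := fun N => (Set.indicator_compl _ _).symm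
  have hnorm0 : Tendsto (fun N : ℕ => mixedNorm q (f - (dyadicBall n (N : ℤ)).indicator f)) atTop
      (𝓝 0) := by
    simp_rw [hcompl, mixedNorm_indicator_eq]
    refine tendsto_mixedENorm_indicator_zero hq hfq.1.enorm hfq.2.ne
      (fun N => (measurableSet_dyadicBall n N).compl) fun x => ?_
    obtain ⟨k, hk⟩ := exists_nat_mem_dyadicBall x
    filter_upwards [eventually_ge_atTop k] with N hN
    exact Set.notMem_compl_iff.2 (dyadicBall_mono (by exact_mod_cast hN) hk)
  have hmem : ∀ N : ℕ, MemMixedLp q (f - (dyadicBall n (N : ℤ)).indicator f) := fun N => by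
    rw [hcompl]
    refine ⟨hfq.1.indicator (measurableSet_dyadicBall n N).compl, lt_of_le_of_lt ?_ hfq.2⟩
    rw [mixedNorm_indicator_eq]
    exact mixedENorm_mono hq fun x => Set.indicator_le_self _ _ x
  have hbd : ∀ N : ℕ, MemMixedLp q (h N) ∧ mixedNorm q (h N) ≤
      A * mixedNorm q (f - (dyadicBall n (N : ℤ)).indicator f) := fun N =>
    hA _ (commutatorDomain_sub hfD (hdom N)) (hmem N)
  -- Norm convergence makes the integrals over a ball tend to zero, and Fatou then gives a vanishing
  -- lower limit. This suffices, as the limit along truncations is already known to exist.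
  have hball : ∀ k : ℕ, ∀ᵐ x, x ∈ dyadicBall n (k : ℤ) →
      liminf (fun N => ‖h N x‖ₑ) atTop = 0 := by
    intro k
    have hk := measurableSet_dyadicBall n k
    set c : ℝ≥0∞ := C * 2 ^ (((k : ℤ) : ℝ) * (n - ∑ i, 1 / q i)) with hc
    have hc1 : c ≠ ∞ := ENNReal.mul_ne_top hC (two_rpow_ne_top _)
    have hle : ∀ N, ∫⁻ x in dyadicBall n (k : ℤ), ‖h N x‖ₑ ≤
        c * (A * mixedNorm q (f - (dyadicBall n (N : ℤ)).indicator f)) := by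
      intro N
      calc _ ≤ ∫⁻ x in dyadicBall n (k : ℤ), (‖b x - ballMean b k‖ₑ + 1) * ‖h N x‖ₑ :=
            lintegral_mono fun x => le_mul_of_one_le_left zero_le le_add_self
        _ ≤ c * mixedNorm q ((dyadicBall n (k : ℤ)).indicator (h N)) :=
            hint _ (hbd N).1.1 k _ hk le_rfl
        _ ≤ _ := by
            gcongr
            refine le_trans ?_ (hbd N).2
            rw [mixedNorm_indicator_eq]
            exact mixedENorm_mono hq fun x => Set.indicator_le_self _ _ x
    have hlim0 : Tendsto (fun N => ∫⁻ x in dyadicBall n (k : ℤ), ‖h N x‖ₑ) atTop (𝓝 0) := by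
      refine tendsto_of_tendsto_of_tendsto_of_le_of_le tendsto_const_nhds ?_ (fun _ => zero_le) hle
      have h1 := ENNReal.Tendsto.const_mul (a := c * A) hnorm0
        (Or.inr (ENNReal.mul_ne_top hc1 ENNReal.coe_ne_top))
      rw [mul_zero] at h1
      refine h1.congr fun N => by ring
    have hmeas : ∀ N, AEMeasurable (fun x => ‖h N x‖ₑ)
        (volume.restrict (dyadicBall n (k : ℤ))) := fun N => (hbd N).1.1.enorm.restrict
    have hliminf : AEMeasurable (fun x => liminf (fun N => ‖h N x‖ₑ) atTop)
        (volume.restrict (dyadicBall n (k : ℤ))) := by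
      refine ⟨fun x => liminf (fun N => (hmeas N).mk _ x) atTop,
        Measurable.liminf fun N => (hmeas N).measurable_mk, ?_⟩
      filter_upwards [ae_all_iff.2 fun N => (hmeas N).ae_eq_mk] with x hx
      simp only [hx]
    have hfatou := lintegral_liminf_le' (u := atTop) hmeas
    rw [hlim0.liminf_eq, nonpos_iff_eq_zero,
      lintegral_eq_zero_iff' hliminf] at hfatou
    exact (ae_restrict_iff' hk).1 hfatou
  have hsub : ∀ᵐ x, ∀ N : ℕ, |‖commutator b T f x‖ -
      ‖commutator b T ((dyadicBall n (N : ℤ)).indicator f) x‖| ≤ ‖h N x‖ := by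
    rw [ae_all_iff]
    exact fun N => hT.abs_norm_commutator_sub_le hfD (hdom N)
  filter_upwards [ae_all_iff.2 hball, hsub, hlim] with x hx1 hx2 ⟨L, hL⟩
  obtain ⟨k, hk⟩ := exists_nat_mem_dyadicBall x
  have hliminf := hx1 k hk
  have h3 : Tendsto (fun N : ℕ => ENNReal.ofReal |‖commutator b T f x‖ -
      ‖commutator b T ((dyadicBall n (N : ℤ)).indicator f) x‖|) atTop
      (𝓝 (ENNReal.ofReal |‖commutator b T f x‖ - L|)) :=
    ENNReal.tendsto_ofReal (tendsto_const_nhds.sub hL).abs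
  have h4 : ENNReal.ofReal |‖commutator b T f x‖ - L| ≤ 0 := by
    rw [← hliminf, ← h3.liminf_eq]
    refine liminf_le_liminf (Eventually.of_forall fun N => ?_)
    rw [← ofReal_norm]
    exact ENNReal.ofReal_le_ofReal (hx2 N)
  have h5 : ‖commutator b T f x‖ = L := by
    have := ENNReal.ofReal_eq_zero.1 (nonpos_iff_eq_zero.1 h4)
    exact sub_eq_zero.1 (abs_nonpos_iff.1 this)
  rwa [h5]

end Truncation

/-! ### Boundedness on Herz–Morrey spaces -/

section Boundedness

variable {𝕜 : Type*} [RCLike 𝕜] {n : ℕ} {b : EuclideanSpace ℝ (Fin n) → 𝕜}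
  {D : Submodule 𝕜 (EuclideanSpace ℝ (Fin n) → 𝕜)}
  {T : (EuclideanSpace ℝ (Fin n) → 𝕜) → EuclideanSpace ℝ (Fin n) → 𝕜} {q : Fin n → ℝ}
  {α lam p : ℝ}

theorem morreySeqNorm_le_of_le_mul (hp : 0 < p) {F G : ℤ → ℝ≥0∞} {c : ℝ≥0∞}
    (h : ∀ k, G k ≤ c * F k) : morreySeqNorm α lam p G ≤ c * morreySeqNorm α lam p F := by
  refine iSup_le fun k₀ => ?_
  calc _ ≤ (2 : ℝ≥0∞) ^ (-(k₀ : ℝ) * lam) *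
        (∑' k : Set.Iic k₀, (2 : ℝ≥0∞) ^ (((k : ℤ) : ℝ) * α * p) * (c * F k) ^ p) ^ (1 / p) := by
        gcongr with k
        exact h k
    _ = c * ((2 : ℝ≥0∞) ^ (-(k₀ : ℝ) * lam) *
        (∑' k : Set.Iic k₀, (2 : ℝ≥0∞) ^ (((k : ℤ) : ℝ) * α * p) * F k ^ p) ^ (1 / p)) := by
        simp_rw [ENNReal.mul_rpow_of_nonneg _ _ hp.le, mul_left_comm _ (c ^ p)]
        rw [ENNReal.tsum_mul_left, ENNReal.mul_rpow_of_nonneg _ _ (one_div_pos.2 hp).le,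
          ← ENNReal.rpow_mul c, mul_one_div_cancel hp.ne', ENNReal.rpow_one]
        ring
    _ ≤ _ := by
        gcongr
        exact le_iSup (fun k₀ : ℤ => (2 : ℝ≥0∞) ^ (-(k₀ : ℝ) * lam) *
          (∑' k : Set.Iic k₀, (2 : ℝ≥0∞) ^ (((k : ℤ) : ℝ) * α * p) * F k ^ p) ^ (1 / p)) k₀

/-- The weight of a neighbouring annulus is at least 2^(-n), since 0 ≤ Q ≤ n. Thus the near part is
absorbed into the same sum as the far part. -/
theorem mixedNorm_annulus_le_annulusSum (hq : ∀ i, 1 < q i)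
    (f : EuclideanSpace ℝ (Fin n) → 𝕜) {j k : ℤ} (hjk : |k - j| ≤ 1) :
    mixedNorm q ((annulus n j).indicator f) ≤ 2 ^ (n : ℝ) * annulusSum q f k := by
  set Q := ∑ i, 1 / q i with hQ
  have hQ0 : 0 ≤ Q := Finset.sum_nonneg fun i _ => by
    have := hq i; positivity
  have hQn : Q ≤ n := by
    calc Q ≤ ∑ _i : Fin n, (1 : ℝ) := Finset.sum_le_sum fun i _ => by
          rw [div_le_one (by linarith [hq i])]; exact (hq i).le
      _ = n := by simp
  have hw : (2 : ℝ≥0∞) ^ (-(n : ℝ)) ≤ annulusWeight Q n (k - j) := by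
    unfold annulusWeight
    refine le_trans ?_ (le_mul_of_one_le_left zero_le ?_)
    · refine two_rpow_mono ?_
      have h1 : |((k - j : ℤ) : ℝ)| ≤ 1 := by exact_mod_cast hjk
      rw [abs_le] at h1
      rcases le_total 0 ((k - j : ℤ) : ℝ) with h | h
      · rw [max_eq_left h]
        nlinarith [mul_nonneg h hQ0]
      · rw [max_eq_right h]
        nlinarith
    · exact_mod_cast Nat.le_add_right 1 _
  have h2 : annulusWeight Q n (k - j) * mixedNorm q ((annulus n j).indicator f) ≤
      annulusSum q f k :=
    ENNReal.le_tsum (f := fun j => annulusWeight Q n (k - j) *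
      mixedNorm q ((annulus n j).indicator f)) j
  calc _ = 2 ^ (n : ℝ) * (2 ^ (-(n : ℝ)) * mixedNorm q ((annulus n j).indicator f)) := by
        rw [← mul_assoc, ← two_rpow_add]; simp
    _ ≤ 2 ^ (n : ℝ) * annulusSum q f k := by
        gcongr
        exact le_trans (by gcongr) h2

theorem mixedNorm_sdiff_dyadicBall_le (hq : ∀ i, 1 < q i)
    {f : EuclideanSpace ℝ (Fin n) → 𝕜} (hf : AEStronglyMeasurable f volume) (k : ℤ) :
    mixedNorm q ((dyadicBall n (k + 1) \ dyadicBall n (k - 2)).indicator f) ≤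
      3 * 2 ^ (n : ℝ) * annulusSum q f k := by
  have hm : ∀ j, AEMeasurable ((annulus n j).indicator fun x => ‖f x‖ₑ) := fun j =>
    hf.enorm.indicator (measurableSet_annulus n j)
  have hpt : ∀ x, (dyadicBall n (k + 1) \ dyadicBall n (k - 2)).indicator (fun x => ‖f x‖ₑ) x ≤
      (annulus n (k + 1)).indicator (fun x => ‖f x‖ₑ) x +
        ((annulus n k).indicator (fun x => ‖f x‖ₑ) x +
          (annulus n (k - 1)).indicator (fun x => ‖f x‖ₑ) x) := by
    intro x
    by_cases hx : x ∈ dyadicBall n (k + 1) \ dyadicBall n (k - 2)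
    · rw [Set.indicator_of_mem hx]
      by_cases h1 : x ∈ dyadicBall n k
      · by_cases h2 : x ∈ dyadicBall n (k - 1)
        · have : x ∈ annulus n (k - 1) := ⟨h2, by
            have := hx.2
            rwa [show k - 1 - 1 = k - 2 by ring]⟩
          rw [Set.indicator_of_mem this]
          exact le_add_self.trans le_add_self
        · have : x ∈ annulus n k := ⟨h1, h2⟩
          rw [Set.indicator_of_mem this]
          exact le_self_add.trans le_add_self
      · have : x ∈ annulus n (k + 1) := ⟨hx.1, by rwa [add_sub_cancel_right]⟩
        rw [Set.indicator_of_mem this]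
        exact le_self_add
    · rw [Set.indicator_of_notMem hx]; exact zero_le
  rw [mixedNorm_indicator_eq]
  calc _ ≤ _ := mixedENorm_mono hq hpt
    _ ≤ _ := mixedENorm_add_le hq (hm _) ((hm _).add (hm _))
    _ ≤ mixedENorm q ((annulus n (k + 1)).indicator fun x => ‖f x‖ₑ) +
        (mixedENorm q ((annulus n k).indicator fun x => ‖f x‖ₑ) +
          mixedENorm q ((annulus n (k - 1)).indicator fun x => ‖f x‖ₑ)) := by
        gcongr
        exact mixedENorm_add_le hq (hm _) (hm _)
    _ ≤ 2 ^ (n : ℝ) * annulusSum q f k +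
        (2 ^ (n : ℝ) * annulusSum q f k + 2 ^ (n : ℝ) * annulusSum q f k) := by
        simp only [← mixedNorm_indicator_eq]
        gcongr
        all_goals exact mixedNorm_annulus_le_annulusSum hq f (by simp)
    _ = _ := by ring

/-- A measurable function whose absolute value is the limit of the commutator along truncations
is controlled in the Herz–Morrey space. -/
theorem exists_herzMorreyNorm_le_of_tendsto (hn : 1 ≤ n) (hlam : 0 ≤ lam) (hp : 0 < p)
    (hq : ∀ i, 1 < q i) (hα_lower : lam - ∑ i, 1 / q i < α) (hα_upper : α < n - ∑ i, 1 / q i)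
    (hb : MemBMO b)
    (hD : ∀ f : EuclideanSpace ℝ (Fin n) → 𝕜, Integrable f volume → HasCompactSupport f → f ∈ D)
    (hT : SublinearOn D T) (hTs : SizeCondition T)
    (hbT : BoundedOnMixedLp q (commutatorDomain D b) (commutator b T)) :
    ∃ C : ℝ≥0, ∀ f g : EuclideanSpace ℝ (Fin n) → 𝕜, MemHerzMorrey α lam p q f →
      AEStronglyMeasurable g volume →
      (∀ᵐ x, Tendsto (fun N : ℕ => ‖commutator b T ((dyadicBall n (N : ℤ)).indicator f) x‖)
        atTop (𝓝 ‖g x‖)) →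
      MemHerzMorrey α lam p q g ∧
        herzMorreyNorm α lam p q g ≤ (C : ℝ≥0∞) * herzMorreyNorm α lam p q f := by
  obtain ⟨C₁, hC₁, hconv⟩ := exists_morreySeqNorm_annulusWeight_le hlam hp hα_lower hα_upper
  obtain ⟨C₂, hC₂, hloc⟩ := exists_mixedNorm_indicator_le_of_tendsto hn hb hq hD hT hTs hbT
  set c : ℝ≥0∞ := C₂ * (3 * 2 ^ (n : ℝ) + 1) with hc
  have hc1 : c ≠ ∞ := ENNReal.mul_ne_top hC₂ (ENNReal.add_ne_top.2
    ⟨ENNReal.mul_ne_top (by simp) (two_rpow_ne_top _), by simp⟩)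
  have hC : c * C₁ ≠ ∞ := ENNReal.mul_ne_top hc1 hC₁
  refine ⟨(c * C₁).toNNReal, fun f g hf hg hlim => ?_⟩
  rw [ENNReal.coe_toNNReal hC]
  -- By definition the Herz–Morrey norm is the sequence norm of the annular norms, and `annulusSum`
  -- is their convolution with the weight.
  have hsumN : morreySeqNorm α lam p (annulusSum q f) ≤ C₁ * herzMorreyNorm α lam p q f :=
    hconv fun j => mixedNorm q ((annulus n j).indicator f)
  have hsum : ∀ k, annulusSum q f k ≠ ∞ := morreySeqNorm_apply_ne_top hp
    (ne_top_of_le_ne_top (ENNReal.mul_ne_top hC₁ hf.2.ne) hsumN)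
  have hann : ∀ k, mixedNorm q ((annulus n k).indicator g) ≤ c * annulusSum q f k := by
    intro k
    have h1 := hloc f g hf.1 hsum hlim k (dyadicBall n (k - 2) ∪ (dyadicBall n (k + 1))ᶜ)
      (annulus n k) (dyadicBall n (k + 1) \ dyadicBall n (k - 2))
      ((measurableSet_dyadicBall n _).union (measurableSet_dyadicBall n _).compl)
      (annulus_subset_dyadicBall n k) (fun x hx => notMem_closure_of_mem_annulus hx)
      (fun x hx j y hy => le_norm_sub_of_mem_annulus hx hy) (by
        filter_upwards [eventually_ge_atTop (k + 1).toNat] with N hN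
        have hsub : dyadicBall n (k + 1) ⊆ dyadicBall n (N : ℤ) := dyadicBall_mono (by omega)
        ext x
        have := @hsub x
        simp only [Set.mem_sdiff, Set.mem_union, Set.mem_compl_iff]
        tauto)
    refine h1.trans ?_
    rw [hc, mul_assoc, add_mul, one_mul]
    gcongr
    exact mixedNorm_sdiff_dyadicBall_le hq hf.1.1 k
  have hnorm : herzMorreyNorm α lam p q g ≤ c * C₁ * herzMorreyNorm α lam p q f := by
    refine (morreySeqNorm_le_of_le_mul hp hann).trans ?_
    rw [mul_assoc c C₁]
    exact mul_le_mul' le_rfl hsumN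
  refine ⟨⟨⟨hg, fun K hK => ?_⟩, lt_of_le_of_lt hnorm (ENNReal.mul_lt_top hC.lt_top hf.2)⟩, hnorm⟩
  obtain ⟨R, hR⟩ := hK.isBounded.exists_norm_le
  obtain ⟨k, hk⟩ := pow_unbounded_of_one_lt R (one_lt_two (α := ℝ))
  have hKk : K ⊆ dyadicBall n (k : ℤ) := fun x hx => by
    simpa [dyadicBall] using (hR x hx).trans hk.le
  -- Local membership needs sets around the origin, which no finite union of annuli covers; here
  -- only the part outside B_{k+1} is treated as far.
  have h1 := hloc f g hf.1 hsum hlim k (dyadicBall n (k + 1))ᶜ K (dyadicBall n (k + 1))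
    (measurableSet_dyadicBall n _).compl hKk
    (fun x hx => notMem_closure_compl_dyadicBall (by omega) (hKk hx))
    (fun x hx j y hy => le_norm_sub_of_mem_dyadicBall (hKk hx) hy) (by
      filter_upwards [eventually_ge_atTop (k + 1)] with N hN
      rw [Set.sdiff_compl]
      exact Set.inter_eq_right.2 (dyadicBall_mono (by omega)))
  refine lt_of_le_of_lt h1 (ENNReal.mul_lt_top hC₂.lt_top (ENNReal.add_lt_top.2
    ⟨hf.1.2 _ ?_, (hsum k).lt_top⟩))
  rw [dyadicBall_eq_closedBall]
  exact isCompact_closedBall _ _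

theorem annulusSum_ne_top_of_memHerzMorrey (hlam : 0 ≤ lam) (hp : 0 < p)
    (hα_lower : lam - ∑ i, 1 / q i < α) (hα_upper : α < n - ∑ i, 1 / q i)
    {f : EuclideanSpace ℝ (Fin n) → 𝕜} (hf : MemHerzMorrey α lam p q f) (k : ℤ) :
    annulusSum q f k ≠ ∞ := by
  obtain ⟨C, hC, hconv⟩ := exists_morreySeqNorm_annulusWeight_le hlam hp hα_lower hα_upper
  exact morreySeqNorm_apply_ne_top hp (ne_top_of_le_ne_top (ENNReal.mul_ne_top hC hf.2.ne)
    (hconv fun j => mixedNorm q ((annulus n j).indicator f))) k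

open Classical in
/-- The commutator, extended to functions outside its domain by the limit of the absolute values
along truncations. -/
noncomputable def extendedCommutator (D : Submodule 𝕜 (EuclideanSpace ℝ (Fin n) → 𝕜))
    (b : EuclideanSpace ℝ (Fin n) → 𝕜)
    (T : (EuclideanSpace ℝ (Fin n) → 𝕜) → EuclideanSpace ℝ (Fin n) → 𝕜) (q : Fin n → ℝ)
    (f : EuclideanSpace ℝ (Fin n) → 𝕜) : EuclideanSpace ℝ (Fin n) → 𝕜 :=
  -- Agreement with the commutator must hold exactly and not only in absolute value, hence the case
  -- distinction. Where the limit fails to exist, `limUnder` takes an arbitrary value; this happens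
  -- only on a null set for the functions considered.
  if f ∈ commutatorDomain D b ∧ MemMixedLp q f then commutator b T f
  else fun x => ((limUnder atTop fun N : ℕ =>
    ‖commutator b T ((dyadicBall n (N : ℤ)).indicator f) x‖ : ℝ) : 𝕜)

/-- Both branches have the limit as absolute value. Measurability comes from boundedness on the
mixed space, applied to `f` itself in the first branch and to its truncations in the second. -/
theorem extendedCommutator_spec (hn : 1 ≤ n) (hb : MemBMO b) (hq : ∀ i, 1 < q i)
    (hD : ∀ f : EuclideanSpace ℝ (Fin n) → 𝕜, Integrable f volume → HasCompactSupport f → f ∈ D)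
    (hT : SublinearOn D T) (hTs : SizeCondition T)
    (hbT : BoundedOnMixedLp q (commutatorDomain D b) (commutator b T))
    {f : EuclideanSpace ℝ (Fin n) → 𝕜} (hf : MemMixedLpLoc q f)
    (hsum : ∀ k, annulusSum q f k ≠ ∞) :
    AEStronglyMeasurable (extendedCommutator D b T q f) volume ∧
      ∀ᵐ x, Tendsto (fun N : ℕ => ‖commutator b T ((dyadicBall n (N : ℤ)).indicator f) x‖)
        atTop (𝓝 ‖extendedCommutator D b T q f x‖) := by
  have hlim := exists_tendsto_norm_commutator hn hb hq hD hT hTs hf hsum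
  by_cases hfD : f ∈ commutatorDomain D b ∧ MemMixedLp q f
  · rw [extendedCommutator, if_pos hfD]
    refine ⟨?_, tendsto_norm_commutator_of_memMixedLp hb hq hD hT hbT hf hfD.2 hfD.1 hlim⟩
    obtain ⟨A, hA⟩ := hbT
    exact (hA f hfD.1 hfD.2).1.1
  · rw [extendedCommutator, if_neg hfD]
    have hlim' : ∀ᵐ x, Tendsto
        (fun N : ℕ => ‖commutator b T ((dyadicBall n (N : ℤ)).indicator f) x‖) atTop
        (𝓝 (limUnder atTop fun N : ℕ =>
          ‖commutator b T ((dyadicBall n (N : ℤ)).indicator f) x‖)) := by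
      filter_upwards [hlim] with x hx
      exact tendsto_nhds_limUnder hx
    constructor
    · refine RCLike.continuous_ofReal.comp_aestronglyMeasurable
        (aestronglyMeasurable_of_tendsto_ae atTop (fun N : ℕ => ?_) hlim')
      obtain ⟨A, hA⟩ := hbT
      have hm := measurableSet_dyadicBall n (N : ℤ)
      exact (hA _ (hb.indicator_mem_commutatorDomain hq hD hf hm le_rfl)
        (hb.integrable_indicator hq hf hm le_rfl).2.2.2).1.1.norm
    · filter_upwards [hlim'] with x hx
      rw [RCLike.norm_ofReal, abs_of_nonneg (ge_of_tendsto' hx fun _ => norm_nonneg _)]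
      exact hx

end Boundedness

end HerzMorrey

/-- `T` is a sublinear operator on a linear space `D` of functions containing all integrable
functions with compact support. If its commutator with `b` is bounded on the mixed Lebesgue space,
then it is bounded on the mixed Herz-Morrey space: it agrees there with an operator `S` bounded on
the whole Herz-Morrey space, and `|S f|` is the limit of the commutator along the truncations of
`f` to the balls `B_N`. -/
theorem corollary4p1 {𝕜 : Type*} [RCLike 𝕜] {n : ℕ} (hn : 1 ≤ n)
    (α lam p : ℝ) (q : Fin n → ℝ)
    (hlam : 0 ≤ lam) (hp : 0 < p) (hq : ∀ i, 1 < q i)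
    (hα_lower : lam - ∑ i, 1 / q i < α) (hα_upper : α < n - ∑ i, 1 / q i)
    (b : EuclideanSpace ℝ (Fin n) → 𝕜) (hb : HerzMorrey.MemBMO b)
    (D : Submodule 𝕜 (EuclideanSpace ℝ (Fin n) → 𝕜))
    (hD : ∀ f : EuclideanSpace ℝ (Fin n) → 𝕜,
      Integrable f volume → HasCompactSupport f → f ∈ D)
    (T : (EuclideanSpace ℝ (Fin n) → 𝕜) → EuclideanSpace ℝ (Fin n) → 𝕜)
    (hT_sublinear : HerzMorrey.SublinearOn D T)
    (hT_size : HerzMorrey.SizeCondition T)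
    (hbT : HerzMorrey.BoundedOnMixedLp q (HerzMorrey.commutatorDomain D b)
      (HerzMorrey.commutator b T)) :
    ∃ S : (EuclideanSpace ℝ (Fin n) → 𝕜) → EuclideanSpace ℝ (Fin n) → 𝕜,
      (∀ f ∈ HerzMorrey.commutatorDomain D b, HerzMorrey.MemMixedLp q f →
        HerzMorrey.MemHerzMorrey α lam p q f → S f = HerzMorrey.commutator b T f) ∧
      (∀ f, HerzMorrey.MemHerzMorrey α lam p q f →
        ∀ᵐ x : EuclideanSpace ℝ (Fin n),
          Tendsto (fun N : ℕ =>
            ‖HerzMorrey.commutator b T ((HerzMorrey.dyadicBall n (N : ℤ)).indicator f) x‖)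
            atTop (𝓝 ‖S f x‖)) ∧
      HerzMorrey.BoundedOnHerzMorrey α lam p q S := by
  have hspec := fun f (hf : HerzMorrey.MemHerzMorrey α lam p q f) =>
    HerzMorrey.extendedCommutator_spec hn hb hq hD hT_sublinear hT_size hbT hf.1
      (HerzMorrey.annulusSum_ne_top_of_memHerzMorrey hlam hp hα_lower hα_upper hf)
  refine ⟨HerzMorrey.extendedCommutator D b T q, fun f hf hfq _ => if_pos ⟨hf, hfq⟩,
    fun f hf => (hspec f hf).2, ?_⟩
  obtain ⟨C, hC⟩ := HerzMorrey.exists_herzMorreyNorm_le_of_tendsto hn hlam hp hq hα_lower hα_upper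
    hb hD hT_sublinear hT_size hbT
  exact ⟨C, fun f hf => hC f _ hf (hspec f hf).1 (hspec f hf).2⟩
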